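/- Let $\xi_1,\xi_2,\dots$ be i.i.d. $\mathcal N(0,1)$ and consider the sequence model $y_k=\theta_k+\sigma_k\xi_k$, $k=1,2,\dots$, with $\sigma_1^2>0$ and $\sum_k\theta_k^2<\infty$. Assume that the noise levels satisfy the polynomial hypothesis of degree $\beta\ge 0$ with constants $C_1,C_2,C_3>0$: for all integers $k>1$ $$C_1\Big(\frac1{2k}\sum_{i=1}^{2k}\sigma_i^4\Big)^{1/2}\le\sigma_k^2\le C_2\sigma_1^2\Big(\frac1{\sigma_1^2}\sum_{i=1}^{k-1}\sigma_i^2\Big)^{2\beta/(2\beta+1)},$$ and for all integers $s>1$ and $k>1$ $$\frac1{\sigma_1^{2s}}\sum_{i=1}^k\sigma_i^{2s}\le C_3^s\Big(\frac1{\sigma_1^2}\sum_{i=1}^k\sigma_i^2\Big)^{(2s\beta+1)/(2\beta+1)}.$$ For $N\ge1$ let $\tilde\theta_k(N)=y_k\mathbf 1(k\le N)$ be the projection estimator, let $\eta_N=\sum_{i=1}^N\sigma_i^2(\xi_i^2-1)$ and $$U_0(N)=\inf\{t>0:\ \mathbf E\,\eta_N\mathbf 1(\eta_N\ge t)\le\sigma_1^2\}.$$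 For $\alpha>1$ let the risk-hull-minimization bandwidth $N_{\rm rhm}$ be a (measurable) minimizer over $N\ge1$ of $$-\sum_{k=1}^Ny_k^2+2\sum_{k=1}^N\sigma_k^2+(1+\alpha)U_0(N),$$ and put $R_{\rm rhm}(\theta,N)=\sum_{k>N}\theta_k^2+\sum_{k=1}^N\sigma_k^2+(1+\alpha)U_0(N)$. Theorem. There exist constants $C_*>0$ and $\gamma_0>0$, depending only on $\beta,C_1,C_2,C_3$, such that for all such $\sigma$ and $\theta$, all $\gamma\in(0,\gamma_0]$ and all $\alpha>1$, a minimizer $N_{\rm rhm}$ exists almost surely and every such $N_{\rm rhm}$ satisfies $$\mathbf E\|\tilde\theta(N_{\rm rhm})-\theta\|^2\le(1+\gamma)\inf_{N\ge1}R_{\rm rhm}(\theta,N)+C_*\sigma_1^2\Big(\frac1{\gamma^{4\beta+1}}+\frac1{\alpha-1}\Big),$$ where $\|\cdot\|$ is the $\ell^2$ norm. -/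

import Mathlib

open MeasureTheory ProbabilityTheory

noncomputable section

/-! Sequences are indexed by `k = 1, 2, …`; the value of a sequence at the index `0` is never used. -/

/-- The polynomial hypothesis of degree `β` on the noise levels `σ₁, σ₂, …`,
with constants `C₁, C₂, C₃`. -/
structure PolynomialHypothesis (β C₁ C₂ C₃ : ℝ) (σ : ℕ → ℝ) : Prop where
  pos : 0 < σ 1 ^ 2
  lower : ∀ k : ℕ, 1 < k →
    C₁ * Real.sqrt (1 / (2 * (k : ℝ)) * ∑ i ∈ Finset.Icc 1 (2 * k), σ i ^ 4) ≤ σ k ^ 2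
  upper : ∀ k : ℕ, 1 < k →
    σ k ^ 2 ≤ C₂ * σ 1 ^ 2 *
      (1 / σ 1 ^ 2 * ∑ i ∈ Finset.Icc 1 (k - 1), σ i ^ 2) ^ (2 * β / (2 * β + 1))
  moment : ∀ s : ℕ, 1 < s → ∀ k : ℕ, 1 < k →
    1 / σ 1 ^ (2 * s) * ∑ i ∈ Finset.Icc 1 k, σ i ^ (2 * s) ≤
      C₃ ^ s * (1 / σ 1 ^ 2 * ∑ i ∈ Finset.Icc 1 k, σ i ^ 2) ^
        ((2 * (s : ℝ) * β + 1) / (2 * β + 1))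

/-- The observations `y_k = θ_k + σ_k ξ_k` of the sequence space model. -/
def observation (θ σ x : ℕ → ℝ) (k : ℕ) : ℝ := θ k + σ k * x k

/-- The projection estimator with bandwidth `N`. -/
def projectionEstimator (y : ℕ → ℝ) (N k : ℕ) : ℝ := if k ≤ N then y k else 0

/-- The squared `ℓ²` distance `∑_{k ≥ 1} (a_k - b_k)²`. -/
def sqDist (a b : ℕ → ℝ) : ℝ := ∑' k : ℕ, (a (k + 1) - b (k + 1)) ^ 2

/-- `η_N = ∑_{i=1}^N σ_i² (ξ_i² - 1)`. -/
def chiSum (σ x : ℕ → ℝ) (N : ℕ) : ℝ := ∑ i ∈ Finset.Icc 1 N, σ i ^ 2 * (x i ^ 2 - 1)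

/-- `U₀(N) = inf {t > 0 : E[η_N 1(η_N ≥ t)] ≤ σ₁²}`. -/
def U0 {Ω : Type*} [MeasurableSpace Ω] (P : Measure Ω) (σ : ℕ → ℝ) (ξ : ℕ → Ω → ℝ) (N : ℕ) : ℝ :=
  sInf {t : ℝ | 0 < t ∧
    ∫ ω, (if t ≤ chiSum σ (fun k => ξ k ω) N then chiSum σ (fun k => ξ k ω) N else 0) ∂P
      ≤ σ 1 ^ 2}

/-- The penalty `pen(N) = ∑_{k=1}^N σ_k² + (1 + α) U(N)`. -/
def penalty (σ U : ℕ → ℝ) (α : ℝ) (N : ℕ) : ℝ :=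
  ∑ k ∈ Finset.Icc 1 N, σ k ^ 2 + (1 + α) * U N

/-- The penalized empirical risk of the data `y` at the bandwidth `N`. -/
def empiricalRisk (σ pen y : ℕ → ℝ) (N : ℕ) : ℝ :=
  -∑ k ∈ Finset.Icc 1 N, y k ^ 2 + ∑ k ∈ Finset.Icc 1 N, σ k ^ 2 + pen N

/-- `N` is a minimizer over `{1, 2, …}` of the penalized empirical risk of the data `y`. -/
def IsBandwidth (σ pen y : ℕ → ℝ) (N : ℕ) : Prop :=
  1 ≤ N ∧ ∀ M : ℕ, 1 ≤ M → empiricalRisk σ pen y N ≤ empiricalRisk σ pen y M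

/-- `∑_{k > N} θ_k² + ∑_{k=1}^N σ_k² + (1 + α) U(N)`. -/
def rhmRisk (θ σ U : ℕ → ℝ) (α : ℝ) (N : ℕ) : ℝ :=
  ∑' k : ℕ, θ (N + 1 + k) ^ 2 + ∑ k ∈ Finset.Icc 1 N, σ k ^ 2 + (1 + α) * U N

end

open scoped ENNReal NNReal

noncomputable section

/-! Write τ = σ₁², S(N) for the normalized variance, T(N) for the squared bias, η_N for the
chi-square sum and X_N = ∑_{k≤N} θ_kσ_kξ_k. The loss at N is T(N) + τS(N) + η_N. Up to a constant
free of N, the empirical risk is the penalized risk minus η_N minus 2X_N. Comparing a minimizer N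
with a fixed N₀ therefore bounds T(N) + τS(N) by the penalized risk at N₀ plus η_N − η_{N₀} + 2(X_N
− X_{N₀}).

It remains to control η_N and X_N − X_{N₀} simultaneously in N, since N is random. With B =
γ^{-2(2β+1)}, the bounds `exists_chiSum_bound`, `exists_cross_term_bound_above` and
`exists_cross_term_bound_below` show that both are at most Kγ times bias and variance terms at N and
N₀, plus τB, with random factors W of bounded mean on the remainders. For small γ the terms at N are
absorbed in the left side, and γτB = τγ^{-(4β+1)} is the announced remainder. Of the penalty only U
≥ 0 matters.

All three bounds come from `exists_bound_weighted_sums`: Doob's inequality for exponentials of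
partial sums, followed by summation by parts against increasing weights. The growth condition on
σ_k² makes the weighted squares summable by telescoping, and a Young-type inequality converts the
weights into variance or bias. -/

/-! ### Maximal inequalities for weighted sums of independent centered variables. -/

theorem submartingale_exp_sum {Ω : Type*} {mΩ : MeasurableSpace Ω} {P : Measure Ω}
    [IsProbabilityMeasure P] {Y : ℕ → Ω → ℝ} (hY : ∀ k, Measurable (Y k)) (hind : iIndepFun Y P)
    (hint : ∀ k, Integrable (Y k) P) (hmean : ∀ k, ∫ ω, Y k ω ∂P = 0)
    (hexp : ∀ k, Integrable (fun ω => Real.exp (Y k ω)) P) :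
    Submartingale (fun n ω => Real.exp (∑ k ∈ Finset.range (n + 1), Y k ω))
      (Filtration.natural Y fun k => (hY k).stronglyMeasurable) P := by
  set ℱ := Filtration.natural Y fun k => (hY k).stronglyMeasurable with hℱ
  have hYad : StronglyAdapted ℱ Y :=
    Filtration.stronglyAdapted_natural fun k => (hY k).stronglyMeasurable
  have hadp : StronglyAdapted ℱ (fun n ω => Real.exp (∑ k ∈ Finset.range (n + 1), Y k ω)) := by
    intro n
    refine Real.continuous_exp.comp_stronglyMeasurable ?_
    refine Finset.stronglyMeasurable_fun_sum _ fun k hk => ?_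
    exact (hYad k).mono (ℱ.mono (Nat.lt_succ_iff.1 (Finset.mem_range.1 hk)))
  have hindep : ∀ n, ∀ s, MeasurableSet[ℱ n] s →
      IndepFun (s.indicator fun ω => Real.exp (∑ k ∈ Finset.range (n + 1), Y k ω))
        (fun ω => Real.exp (Y (n + 1) ω)) P := by
    intro n s hs
    have h := (hind.indep_comap_natural_of_lt (fun k => (hY k).stronglyMeasurable)
      (Nat.lt_succ_self n)).symm
    rw [IndepFun_iff_Indep]
    refine indep_of_indep_of_le_left (indep_of_indep_of_le_right h ?_) ?_
    · rw [← measurable_iff_comap_le]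
      exact Real.measurable_exp.comp (comap_measurable _)
    · rw [← measurable_iff_comap_le]
      exact ((hadp n).measurable).indicator hs
  have hI : ∀ n, Integrable (fun ω => Real.exp (∑ k ∈ Finset.range (n + 1), Y k ω)) P := by
    intro n
    induction n with
    | zero => simpa using hexp 0
    | succ n ih =>
      have h := (hindep n Set.univ MeasurableSet.univ).integrable_mul
        (by simpa using ih) (hexp (n + 1))
      refine h.congr (Filter.Eventually.of_forall fun ω => ?_)
      simp [Finset.sum_range_succ _ (n + 1), Real.exp_add]
  refine submartingale_of_setIntegral_le_succ hadp hI fun n s hs => ?_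
  have hs' : MeasurableSet s := ℱ.le n s hs
  -- By 1 + y ≤ e^y, a centered variable has exponential moment at least 1; this is what makes the
  -- product a submartingale.
  have h1 : (1 : ℝ) ≤ ∫ ω, Real.exp (Y (n + 1) ω) ∂P := by
    have : ∫ ω, (Y (n + 1) ω + 1) ∂P ≤ ∫ ω, Real.exp (Y (n + 1) ω) ∂P :=
      integral_mono ((hint _).add (integrable_const _)) (hexp _) fun ω => Real.add_one_le_exp _
    rw [integral_add (hint _) (integrable_const _), hmean] at this
    simpa using this
  have h2 := (hindep n s hs).integral_fun_mul_eq_mul_integral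
    ((hI n).indicator hs').aestronglyMeasurable (hexp (n + 1)).aestronglyMeasurable
  rw [← integral_indicator hs', ← integral_indicator hs']
  have h3 : (s.indicator fun ω => Real.exp (∑ k ∈ Finset.range (n + 1 + 1), Y k ω)) =
      fun ω => s.indicator (fun ω => Real.exp (∑ k ∈ Finset.range (n + 1), Y k ω)) ω *
        Real.exp (Y (n + 1) ω) := by
    funext ω
    by_cases hω : ω ∈ s <;> simp [hω, Finset.sum_range_succ _ (n + 1), Real.exp_add]
  rw [h3, h2]
  refine le_mul_of_one_le_right (integral_nonneg fun ω => ?_) h1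
  exact Set.indicator_nonneg (fun _ _ => (Real.exp_pos _).le) _

/-- Exponential moments of a sum of independent random variables. -/
theorem integral_exp_sum_le {Ω : Type*} {mΩ : MeasurableSpace Ω} {P : Measure Ω}
    [IsProbabilityMeasure P] {Y : ℕ → Ω → ℝ} (hY : ∀ k, Measurable (Y k)) (hind : iIndepFun Y P)
    {v : ℕ → ℝ} (hle : ∀ k, ∫ ω, Real.exp (Y k ω) ∂P ≤ Real.exp (v k)) (n : ℕ) :
    ∫ ω, Real.exp (∑ k ∈ Finset.range n, Y k ω) ∂P ≤ Real.exp (∑ k ∈ Finset.range n, v k) := by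
  have h := hind.mgf_sum hY (t := 1) (Finset.range n)
  simp only [mgf, one_mul, Finset.sum_apply] at h
  rw [h, Real.exp_sum]
  exact Finset.prod_le_prod (fun k _ => integral_nonneg fun ω => (Real.exp_pos _).le)
    fun k _ => hle k

/-- Doob's maximal inequality up to time n gives a bound independent of n; continuity of the measure
along increasing events passes to all times. -/
theorem measure_exists_lt_exp_sum_le {Ω : Type*} {mΩ : MeasurableSpace Ω} {P : Measure Ω}
    [IsProbabilityMeasure P] {Y : ℕ → Ω → ℝ} (hY : ∀ k, Measurable (Y k)) (hind : iIndepFun Y P)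
    (hint : ∀ k, Integrable (Y k) P) (hmean : ∀ k, ∫ ω, Y k ω ∂P = 0)
    (hexp : ∀ k, Integrable (fun ω => Real.exp (Y k ω)) P)
    {v : ℕ → ℝ} {V : ℝ} (hle : ∀ k, ∫ ω, Real.exp (Y k ω) ∂P ≤ Real.exp (v k))
    (hV : ∀ n, ∑ k ∈ Finset.range n, v k ≤ V) {x : ℝ} (hx : 0 < x) :
    P {ω | ∃ n, x < Real.exp (∑ k ∈ Finset.range (n + 1), Y k ω)} ≤
      ENNReal.ofReal (Real.exp V / x) := by
  have hsub := submartingale_exp_sum hY hind hint hmean hexp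
  set f : ℕ → Ω → ℝ := fun n ω => Real.exp (∑ k ∈ Finset.range (n + 1), Y k ω) with hf
  have hset : {ω | ∃ n, x < Real.exp (∑ k ∈ Finset.range (n + 1), Y k ω)} =
      ⋃ n, {ω | ∃ k ≤ n, x < f k ω} := by
    ext ω
    simp only [Set.mem_ofPred_eq, Set.mem_iUnion, hf]
    exact ⟨fun ⟨n, h⟩ => ⟨n, n, le_rfl, h⟩, fun ⟨_, k, _, h⟩ => ⟨k, h⟩⟩
  rw [hset, Monotone.measure_iUnion]
  swap
  · exact fun m n hmn ω ⟨k, hk, h⟩ => ⟨k, hk.trans hmn, h⟩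
  refine iSup_le fun n => ?_
  have hmax := maximal_ineq hsub (fun n ω => (Real.exp_pos _).le) (ε := x.toNNReal) n
  have hx' : (ENNReal.ofReal x) ≠ 0 := by simpa using hx
  have h1 : P {ω | ∃ k ≤ n, x < f k ω} ≤ P {ω | ((x.toNNReal : ℝ≥0) : ℝ) ≤
      (Finset.range (n + 1)).sup' Finset.nonempty_range_add_one fun k => f k ω} := by
    refine measure_mono fun ω ⟨k, hk, h⟩ => ?_
    simp only [Set.mem_ofPred_eq, Real.coe_toNNReal _ hx.le]
    exact (Finset.le_sup'_iff _).2 ⟨k, Finset.mem_range.2 (by omega), h.le⟩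
  rw [ENNReal.ofReal_div_of_pos hx, ENNReal.le_div_iff_mul_le (Or.inl hx')
    (Or.inl ENNReal.ofReal_ne_top), mul_comm]
  refine (mul_le_mul_right h1 _).trans (hmax.trans (ENNReal.ofReal_le_ofReal ?_))
  refine (setIntegral_le_integral (hsub.integrable n)
    (Filter.Eventually.of_forall fun ω => (Real.exp_pos _).le)).trans ?_
  exact (integral_exp_sum_le hY hind hle (n + 1)).trans (Real.exp_le_exp.2 (hV _))

theorem lintegral_Ioi_one_div_sq {c : ℝ} (hc : 0 ≤ c) :
    ∫⁻ t in Set.Ioi (1 : ℝ), ENNReal.ofReal (c / t ^ 2) = ENNReal.ofReal c := by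
  have h := integrableOn_Ioi_rpow_of_lt (a := -2) (by norm_num) (zero_lt_one' ℝ)
  have h2 := integral_Ioi_rpow_of_lt (a := -2) (by norm_num) (zero_lt_one' ℝ)
  rw [setLIntegral_congr_fun (g := fun t => ENNReal.ofReal (c * t ^ (-2 : ℝ))) measurableSet_Ioi,
    ← ofReal_integral_eq_lintegral_ofReal (h.const_mul c), integral_const_mul, h2]
  · norm_num
  · refine (ae_restrict_mem measurableSet_Ioi).mono fun t ht => ?_
    have : (0 : ℝ) < t := zero_lt_one.trans ht
    positivity
  · intro t ht
    have : (0 : ℝ) < t := zero_lt_one.trans ht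
    simp only
    rw [Real.rpow_neg this.le, ← div_eq_mul_inv]
    norm_num

/-- The maximum of the partial sums of independent centered variables has an exponential moment. -/
theorem exists_bound_partial_sums {Ω : Type*} {mΩ : MeasurableSpace Ω} {P : Measure Ω}
    [IsProbabilityMeasure P] {Y : ℕ → Ω → ℝ} (hY : ∀ k, Measurable (Y k)) (hind : iIndepFun Y P)
    (hint : ∀ k, Integrable (Y k) P) (hmean : ∀ k, ∫ ω, Y k ω ∂P = 0)
    (hexp : ∀ k, Integrable (fun ω => Real.exp (Y k ω)) P)
    (hexp' : ∀ k, Integrable (fun ω => Real.exp (-Y k ω)) P)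
    {v : ℕ → ℝ} {V : ℝ} (hle : ∀ k, ∫ ω, Real.exp (Y k ω) ∂P ≤ Real.exp (v k))
    (hle' : ∀ k, ∫ ω, Real.exp (-Y k ω) ∂P ≤ Real.exp (v k))
    (hV : ∀ n, ∑ k ∈ Finset.range n, v k ≤ V) :
    ∃ M : Ω → ℝ, Measurable M ∧ (∀ ω, 0 ≤ M ω) ∧ Integrable (fun ω => Real.exp (M ω / 2)) P ∧
      ∫ ω, Real.exp (M ω / 2) ∂P ≤ 1 + 2 * Real.exp V ∧
      ∀ᵐ ω ∂P, ∀ n, |∑ k ∈ Finset.range (n + 1), Y k ω| ≤ M ω := by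
  have htail : ∀ x : ℝ, 0 < x → P {ω | ∃ n, x < Real.exp |∑ k ∈ Finset.range (n + 1), Y k ω|} ≤
      ENNReal.ofReal (2 * Real.exp V / x) := by
    intro x hx
    have h1 := measure_exists_lt_exp_sum_le hY hind hint hmean hexp hle hV hx
    have h2 := measure_exists_lt_exp_sum_le (Y := fun k ω => -Y k ω) (fun k => (hY k).neg)
      (hind.comp (fun _ x => -x) fun _ => measurable_neg) (fun k => (hint k).neg)
      (fun k => by rw [integral_neg, hmean, neg_zero]) hexp' hle' hV hx
    have h3 : {ω | ∃ n, x < Real.exp |∑ k ∈ Finset.range (n + 1), Y k ω|} ⊆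
        {ω | ∃ n, x < Real.exp (∑ k ∈ Finset.range (n + 1), Y k ω)} ∪
        {ω | ∃ n, x < Real.exp (∑ k ∈ Finset.range (n + 1), -Y k ω)} := by
      rintro ω ⟨n, hn⟩
      rcases abs_choice (∑ k ∈ Finset.range (n + 1), Y k ω) with h | h
      · exact Or.inl ⟨n, by rwa [h] at hn⟩
      · exact Or.inr ⟨n, by rwa [h, ← Finset.sum_neg_distrib] at hn⟩
    refine (measure_mono h3).trans ((measure_union_le _ _).trans ((add_le_add h1 h2).trans ?_))
    rw [← ENNReal.ofReal_add (by positivity) (by positivity)]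
    exact ENNReal.ofReal_le_ofReal (by ring_nf; rfl)
  have hmeas : ∀ n, Measurable fun ω => |∑ k ∈ Finset.range (n + 1), Y k ω| := fun n =>
    (Finset.measurable_sum _ fun k _ => hY k).abs
  -- The real supremum is 0 where the partial sums are unbounded. That set is shown below to be
  -- null, so `M` dominates only almost everywhere.
  set M : Ω → ℝ := fun ω => ⨆ n, |∑ k ∈ Finset.range (n + 1), Y k ω| with hM
  have hMmeas : Measurable M := .iSup hmeas
  have hM0 : ∀ ω, 0 ≤ M ω := fun ω => Real.iSup_nonneg fun n => abs_nonneg _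
  have hbdd : ∀ᵐ ω ∂P, BddAbove (Set.range fun n => |∑ k ∈ Finset.range (n + 1), Y k ω|) := by
    have hnull : P {ω | ¬ BddAbove (Set.range fun n => |∑ k ∈ Finset.range (n + 1), Y k ω|)} = 0 := by
      have hlim : Filter.Tendsto (fun x : ℝ => ENNReal.ofReal (2 * Real.exp V / x)) Filter.atTop
          (nhds 0) := by
        rw [← ENNReal.ofReal_zero]
        exact ENNReal.tendsto_ofReal (tendsto_const_nhds.div_atTop Filter.tendsto_id)
      refine le_antisymm (ge_of_tendsto hlim ?_) bot_le
      filter_upwards [Filter.eventually_gt_atTop 0] with x hx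
      refine (measure_mono fun ω hω => ?_).trans (htail x hx)
      by_contra hcon
      refine hω ⟨Real.log x, ?_⟩
      rintro _ ⟨n, rfl⟩
      rw [Real.le_log_iff_exp_le hx]
      by_contra h
      exact hcon ⟨n, not_le.1 h⟩
    exact hnull
  have hlint : ∫⁻ ω, ENNReal.ofReal (Real.exp (M ω / 2)) ∂P ≤
      ENNReal.ofReal (1 + 2 * Real.exp V) := by
    rw [lintegral_eq_lintegral_meas_lt P (Filter.Eventually.of_forall fun ω => (Real.exp_pos _).le)
      (Real.measurable_exp.comp (hMmeas.div_const 2)).aemeasurable]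
    rw [← Set.Ioc_union_Ioi_eq_Ioi (zero_le_one' ℝ), ENNReal.ofReal_add zero_le_one (by positivity)]
    refine (lintegral_union_le _ _ _).trans (add_le_add ?_ ?_)
    · refine (lintegral_mono fun t => prob_le_one).trans ?_
      simp
    · rw [← lintegral_Ioi_one_div_sq (by positivity : (0 : ℝ) ≤ 2 * Real.exp V)]
      refine setLIntegral_mono_ae (by fun_prop) (Filter.Eventually.of_forall fun t ht => ?_)
      have ht0 : (0 : ℝ) < t := zero_lt_one.trans ht
      -- The event e^{M/2} > t is e^M > t²; halving the exponent turns the nonintegrable tail 1/t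
      -- into 1/t².
      refine (measure_mono fun ω hω => ?_).trans (htail (t ^ 2) (by positivity))
      have hω' : 2 * Real.log t < M ω := by
        have := (Real.log_lt_iff_lt_exp ht0).2 hω
        linarith
      obtain ⟨n, hn⟩ := exists_lt_of_lt_ciSup hω'
      refine ⟨n, ?_⟩
      rw [← Real.log_lt_iff_lt_exp (by positivity), Real.log_pow]
      exact_mod_cast hn
  have hE0 : 0 ≤ᵐ[P] fun ω => Real.exp (M ω / 2) :=
    Filter.Eventually.of_forall fun ω => (Real.exp_pos _).le
  have hEm : AEStronglyMeasurable (fun ω => Real.exp (M ω / 2)) P :=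
    (Real.measurable_exp.comp (hMmeas.div_const 2)).aestronglyMeasurable
  refine ⟨M, hMmeas, hM0, ?_, ?_, hbdd.mono fun ω hω n => le_ciSup hω n⟩
  · refine (lintegral_ofReal_ne_top_iff_integrable hEm hE0).1 ?_
    exact ne_top_of_le_ne_top ENNReal.ofReal_ne_top hlint
  · rw [integral_eq_lintegral_of_nonneg_ae hE0 hEm]
    exact ENNReal.toReal_le_of_le_ofReal (by positivity) hlint

/-- Summation by parts: the weighted sum differs from w_n times the plain sum by increments of w
against partial sums, which contribute at most w_n M. -/
theorem abs_sum_mul_le_of_monotone {w y : ℕ → ℝ} {M : ℝ} (hw : Monotone w) (hw0 : 0 ≤ w 0)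
    (h : ∀ n, |∑ k ∈ Finset.range (n + 1), y k| ≤ M) (n : ℕ) :
    |∑ k ∈ Finset.range (n + 1), w k * y k| ≤ 2 * w n * M := by
  have key : ∀ n, |∑ k ∈ Finset.range (n + 1), w k * y k - w n * ∑ k ∈ Finset.range (n + 1), y k| ≤
      w n * M := by
    intro n
    induction n with
    | zero =>
      have hM : 0 ≤ M := (abs_nonneg _).trans (h 0)
      simpa using mul_nonneg hw0 hM
    | succ n ih =>
      have hd : 0 ≤ w (n + 1) - w n := sub_nonneg.2 (hw n.le_succ)
      have e : ∑ k ∈ Finset.range (n + 1 + 1), w k * y k -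
          w (n + 1) * ∑ k ∈ Finset.range (n + 1 + 1), y k =
          (∑ k ∈ Finset.range (n + 1), w k * y k - w n * ∑ k ∈ Finset.range (n + 1), y k) -
          (w (n + 1) - w n) * ∑ k ∈ Finset.range (n + 1), y k := by
        rw [Finset.sum_range_succ _ (n + 1), Finset.sum_range_succ _ (n + 1)]
        ring
      rw [e]
      refine (abs_sub _ _).trans ?_
      rw [abs_mul, abs_of_nonneg hd]
      nlinarith [mul_le_mul_of_nonneg_left (h n) hd]
  have hwn : 0 ≤ w n := hw0.trans (hw n.zero_le)
  have h1 := key n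
  have h2 : |w n * ∑ k ∈ Finset.range (n + 1), y k| ≤ w n * M := by
    rw [abs_mul, abs_of_nonneg hwn]
    exact mul_le_mul_of_nonneg_left (h n) hwn
  have h3 := abs_add_le (∑ k ∈ Finset.range (n + 1), w k * y k -
    w n * ∑ k ∈ Finset.range (n + 1), y k) (w n * ∑ k ∈ Finset.range (n + 1), y k)
  rw [sub_add_cancel] at h3
  linarith

/-- Centered variables whose exponential moments near the origin are bounded like those of a
normal variable. -/
structure IsCenteredSubexponential {Ω : Type*} [MeasurableSpace Ω] (P : Measure Ω) (g : Ω → ℝ) :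
    Prop where
  integrable : Integrable g P
  mean : ∫ ω, g ω ∂P = 0
  exp : ∀ c : ℝ, |c| ≤ 1 / 4 → Integrable (fun ω => Real.exp (c * g ω)) P ∧
    ∫ ω, Real.exp (c * g ω) ∂P ≤ Real.exp (4 * c ^ 2)

theorem IsCenteredSubexponential.congr {Ω : Type*} [MeasurableSpace Ω] {P : Measure Ω}
    {g g' : Ω → ℝ} (hg : IsCenteredSubexponential P g) (h : g =ᵐ[P] g') :
    IsCenteredSubexponential P g' := by
  refine ⟨hg.integrable.congr h, (integral_congr_ae h).symm.trans hg.mean, fun c hc => ?_⟩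
  have h' : (fun ω => Real.exp (c * g ω)) =ᵐ[P] fun ω => Real.exp (c * g' ω) :=
    h.mono fun ω hω => by simp only [hω]
  exact ⟨(hg.exp c hc).1.congr h', (integral_congr_ae h').symm.trans_le (hg.exp c hc).2⟩

/-- A weighted maximal inequality for sums of independent centered variables. -/
theorem exists_bound_weighted_sums {Ω : Type*} [MeasurableSpace Ω] {P : Measure Ω}
    [IsProbabilityMeasure P] {g : ℕ → Ω → ℝ} (hind : iIndepFun g P)
    (hg : ∀ k, IsCenteredSubexponential P (g k)) {a w : ℕ → ℝ} (hw : Monotone w) (hw0 : 0 < w 0)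
    (hsum : ∀ n, ∑ k ∈ Finset.range n, (a k / w k) ^ 2 ≤ 1 / 16) :
    ∃ M : Ω → ℝ, Measurable M ∧ (∀ ω, 0 ≤ M ω) ∧ Integrable (fun ω => Real.exp (M ω / 2)) P ∧
      ∫ ω, Real.exp (M ω / 2) ∂P ≤ 4 ∧
      ∀ᵐ ω ∂P, ∀ n, |∑ k ∈ Finset.range (n + 1), a k * g k ω| ≤ 2 * w n * M ω := by
  have hgm : ∀ k, AEMeasurable (g k) P := fun k => (hg k).integrable.aemeasurable
  set g' : ℕ → Ω → ℝ := fun k => (hgm k).mk (g k) with hg'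
  have hae : ∀ k, g k =ᵐ[P] g' k := fun k => (hgm k).ae_eq_mk
  have hind' : iIndepFun g' P := hind.congr hae
  have hsub : ∀ k, IsCenteredSubexponential P (g' k) := fun k => (hg k).congr (hae k)
  -- The bound 1/16 serves twice: each ratio stays in the range |c| ≤ 1/4 of the exponential moment
  -- bound, and the total exponent is at most 4 · 1/16 = 1/4, so that 1 + 2e^{1/4} ≤ 4.
  have hc : ∀ k, |a k / w k| ≤ 1 / 4 := by
    intro k
    refine abs_le_of_sq_le_sq ?_ (by norm_num)
    have h := hsum (k + 1)
    rw [Finset.sum_range_succ] at h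
    have h0 : 0 ≤ ∑ k ∈ Finset.range k, (a k / w k) ^ 2 := Finset.sum_nonneg fun _ _ => sq_nonneg _
    norm_num
    linarith
  have hexp : ∀ k, Integrable (fun ω => Real.exp (a k / w k * g' k ω)) P ∧
      ∫ ω, Real.exp (a k / w k * g' k ω) ∂P ≤ Real.exp (4 * (a k / w k) ^ 2) :=
    fun k => (hsub k).exp _ (hc k)
  have hexp' : ∀ k, Integrable (fun ω => Real.exp (-(a k / w k * g' k ω))) P ∧
      ∫ ω, Real.exp (-(a k / w k * g' k ω)) ∂P ≤ Real.exp (4 * (a k / w k) ^ 2) := by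
    intro k
    have := (hsub k).exp (-(a k / w k)) (by rw [abs_neg]; exact hc k)
    simpa only [neg_mul, neg_sq] using this
  obtain ⟨M, hMm, hM0, hMi, hMle, hMb⟩ := exists_bound_partial_sums
    (Y := fun k ω => a k / w k * g' k ω) (P := P) (V := 1 / 4)
    (fun k => ((hgm k).measurable_mk).const_mul _)
    (hind'.comp (fun k x => a k / w k * x) fun k => measurable_const_mul _)
    (fun k => (hsub k).integrable.const_mul _)
    (fun k => by rw [integral_const_mul, (hsub k).mean, mul_zero])
    (fun k => (hexp k).1) (fun k => (hexp' k).1) (fun k => (hexp k).2) (fun k => (hexp' k).2)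
    (fun n => by rw [← Finset.mul_sum]; linarith [hsum n])
  refine ⟨M, hMm, hM0, hMi, hMle.trans ?_, ?_⟩
  · have h1 : Real.exp (1 / 4) ≤ 3 / 2 := by
      have h2 := Real.exp_bound_div_one_sub_of_interval (x := 1 / 4) (by norm_num) (by norm_num)
      norm_num at h2
      norm_num
      linarith
    linarith
  · filter_upwards [hMb, ae_all_iff.2 hae] with ω hω hω' n
    have h := abs_sum_mul_le_of_monotone hw hw0.le hω n
    have e : ∑ k ∈ Finset.range (n + 1), w k * (a k / w k * g' k ω) =
        ∑ k ∈ Finset.range (n + 1), a k * g k ω := by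
      refine Finset.sum_congr rfl fun k _ => ?_
      have : w k ≠ 0 := (hw0.trans_le (hw k.zero_le)).ne'
      rw [hω' k]
      field_simp
    rwa [e] at h

/-! ### Real inequalities: Young-type splitting, telescoping of powers, powers against exponentials.
-/

/-- Whichever of x and y^{1/r} is larger dominates the product. This trades a weight x^{1−r} times a
random factor y for x itself plus a moment of y. -/
theorem rpow_one_sub_mul_le_add {x y r : ℝ} (hx : 0 < x) (hy : 0 ≤ y) (hr : 0 < r) (hr1 : r ≤ 1) :
    x ^ (1 - r) * y ≤ x + y ^ (1 / r) := by
  rcases le_total y (x ^ r) with h | h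
  · calc x ^ (1 - r) * y ≤ x ^ (1 - r) * x ^ r := by gcongr
      _ = x := by rw [← Real.rpow_add hx, sub_add_cancel, Real.rpow_one]
      _ ≤ x + y ^ (1 / r) := le_add_of_nonneg_right (by positivity)
  · have hx' : x ≤ y ^ (1 / r) := by
      have := Real.rpow_le_rpow (by positivity) h (by positivity : 0 ≤ 1 / r)
      rwa [← Real.rpow_mul hx.le, mul_one_div_cancel hr.ne', Real.rpow_one] at this
    have hy0 : 0 < y := lt_of_lt_of_le (by positivity) h
    calc x ^ (1 - r) * y ≤ (y ^ (1 / r)) ^ (1 - r) * y :=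
          mul_le_mul_of_nonneg_right (Real.rpow_le_rpow hx.le hx' (by linarith)) hy
      _ = y ^ (1 / r) := by
          rw [← Real.rpow_mul hy]
          nth_rewrite 2 [← Real.rpow_one y]
          rw [← Real.rpow_add hy0]
          congr 1
          field_simp
          ring
      _ ≤ x + y ^ (1 / r) := by linarith

/-- A discrete form of ∫_x^y u^{-1-ε} du, obtained from 1 − 1/z ≤ log z and 1 + ε log z ≤ z^ε at z =
y/x. -/
theorem sub_mul_rpow_le {x y ε : ℝ} (hx : 0 < x) (hxy : x ≤ y) (hε : 0 < ε) :
    (y - x) * y ^ (-(1 + ε)) ≤ (x ^ (-ε) - y ^ (-ε)) / ε := by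
  have hy : 0 < y := hx.trans_le hxy
  have h1 : 1 - x / y ≤ Real.log (y / x) := by
    have := Real.one_sub_inv_le_log_of_pos (div_pos hy hx)
    rwa [inv_div] at this
  have h2 : ε * Real.log (y / x) + 1 ≤ (y / x) ^ ε := by
    rw [Real.rpow_def_of_pos (div_pos hy hx), mul_comm ε]
    exact Real.add_one_le_exp _
  have h3 : x ^ (-ε) = y ^ (-ε) * (y / x) ^ ε := by
    rw [Real.div_rpow hy.le hx.le, Real.rpow_neg hy.le, Real.rpow_neg hx.le]
    have : y ^ ε ≠ 0 := by positivity
    field_simp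
  have h4 : (y - x) * y ^ (-(1 + ε)) = (1 - x / y) * y ^ (-ε) := by
    rw [neg_add, Real.rpow_add hy, Real.rpow_neg_one]
    field_simp
  rw [h4, le_div_iff₀ hε, h3]
  have h5 : 0 < y ^ (-ε) := by positivity
  nlinarith [mul_le_mul_of_nonneg_left h1 hε.le]

theorem sum_sub_mul_rpow_le {s : ℕ → ℝ} (hs0 : 0 < s 0) (hs : Monotone s) {ε : ℝ} (hε : 0 < ε)
    (n : ℕ) :
    ∑ k ∈ Finset.range n, (s (k + 1) - s k) * s (k + 1) ^ (-(1 + ε)) ≤ s 0 ^ (-ε) / ε := by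
  have hpos : ∀ k, 0 < s k := fun k => hs0.trans_le (hs k.zero_le)
  calc ∑ k ∈ Finset.range n, (s (k + 1) - s k) * s (k + 1) ^ (-(1 + ε))
      ≤ ∑ k ∈ Finset.range n, (s k ^ (-ε) / ε - s (k + 1) ^ (-ε) / ε) := by
        refine Finset.sum_le_sum fun k _ => ?_
        rw [← sub_div]
        exact sub_mul_rpow_le (hpos k) (hs k.le_succ) hε
    _ = s 0 ^ (-ε) / ε - s n ^ (-ε) / ε := Finset.sum_range_sub' (fun k => s k ^ (-ε) / ε) n
    _ ≤ s 0 ^ (-ε) / ε := sub_le_self _ (by have := hpos n; positivity)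

theorem exists_rpow_le_exp {r : ℝ} (hr : 0 ≤ r) :
    ∃ C : ℝ, 0 < C ∧ ∀ x : ℝ, 0 ≤ x → x ^ r ≤ C * Real.exp (x / 2) := by
  obtain ⟨n, hn⟩ := exists_nat_ge r
  refine ⟨1 + 2 ^ n * n.factorial, by positivity, fun x hx => ?_⟩
  have h1 : 1 ≤ Real.exp (x / 2) := Real.one_le_exp (by positivity)
  have h2 : x ^ n ≤ 2 ^ n * n.factorial * Real.exp (x / 2) := by
    have h := Real.pow_div_factorial_le_exp (x / 2) (by positivity) n
    rw [div_pow, div_div, div_le_iff₀ (by positivity)] at h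
    linarith
  rcases le_total x 1 with h | h
  · have := Real.rpow_le_one hx h hr
    have : 0 < 2 ^ n * (n.factorial : ℝ) * Real.exp (x / 2) := by positivity
    linarith
  · have h3 : x ^ r ≤ x ^ n := by
      rw [← Real.rpow_natCast]
      exact Real.rpow_le_rpow_of_exponent_le h hn
    linarith

/-! ### Exponential moments of a standard normal variable and of its centered square. -/

theorem gaussian_isCenteredSubexponential {Ω : Type*} [MeasurableSpace Ω] {P : Measure Ω}
    {X : Ω → ℝ} (hX : HasLaw X (gaussianReal 0 1) P) : IsCenteredSubexponential P X := by
  refine ⟨?_, ?_, fun c _ => ⟨?_, ?_⟩⟩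
  · have h : Integrable (fun x : ℝ => x) (P.map X) := by
      rw [hX.map_eq]
      exact (memLp_id_gaussianReal 1).integrable le_rfl
    exact h.comp_aemeasurable hX.aemeasurable
  · rw [hX.integral_eq]
    simp
  · have h : Integrable (fun x : ℝ => Real.exp (c * x)) (P.map X) := by
      rw [hX.map_eq]
      exact integrable_exp_mul_gaussianReal c
    exact h.comp_aemeasurable hX.aemeasurable
  · have h := mgf_gaussianReal hX.map_eq c
    rw [mgf] at h
    rw [h]
    refine Real.exp_le_exp.2 ?_
    norm_num
    nlinarith [sq_nonneg c]

theorem integral_sq_gaussianReal : ∫ x, x ^ 2 ∂(gaussianReal 0 1) = 1 := by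
  have h := variance_of_integral_eq_zero (μ := gaussianReal 0 1) (X := fun x => x)
    aemeasurable_id (by simp)
  rw [variance_fun_id_gaussianReal] at h
  simpa using h.symm

theorem exp_mul_sq_sub_one_eq (c x : ℝ) :
    gaussianPDFReal 0 1 x * Real.exp (c * (x ^ 2 - 1)) =
      (√(2 * Real.pi))⁻¹ * Real.exp (-c) * Real.exp (-(1 / 2 - c) * x ^ 2) := by
  simp only [gaussianPDFReal, NNReal.coe_one, mul_one, sub_zero]
  rw [mul_assoc, mul_assoc, ← Real.exp_add, ← Real.exp_add]
  ring_nf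

theorem integrable_exp_mul_sq_gaussianReal {c : ℝ} (hc : c < 1 / 2) :
    Integrable (fun x => Real.exp (c * (x ^ 2 - 1))) (gaussianReal 0 1) := by
  rw [gaussianReal_of_var_ne_zero _ one_ne_zero,
    integrable_withDensity_iff_integrable_smul' (measurable_gaussianPDF 0 1)
      (Filter.Eventually.of_forall fun _ => gaussianPDF_lt_top)]
  simp only [toReal_gaussianPDF, smul_eq_mul, exp_mul_sq_sub_one_eq]
  exact (integrable_exp_neg_mul_sq (by linarith)).const_mul _

theorem integral_exp_mul_sq_gaussianReal {c : ℝ} (hc : c < 1 / 2) :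
    ∫ x, Real.exp (c * (x ^ 2 - 1)) ∂(gaussianReal 0 1) =
      Real.exp (-c) * (√(1 - 2 * c))⁻¹ := by
  rw [integral_gaussianReal_eq_integral_smul one_ne_zero]
  simp only [smul_eq_mul, exp_mul_sq_sub_one_eq]
  rw [integral_const_mul, integral_gaussian]
  have h1 : Real.pi / (1 / 2 - c) = (2 * Real.pi) * (1 - 2 * c)⁻¹ := by
    have : 1 - 2 * c ≠ 0 := by linarith
    have : 1 / 2 - c ≠ 0 := by linarith
    field_simp
  rw [h1, Real.sqrt_mul (show 0 ≤ 2 * Real.pi by positivity) (1 - 2 * c)⁻¹, Real.sqrt_inv]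
  have : √(2 * Real.pi) ≠ 0 := by positivity
  field_simp

/-- The exponent is −c − ½ log(1 − 2c), whose first-order terms cancel. For |2c| ≤ 1/2 the remainder
of the logarithm is at most 8c², and halving gives 4c². -/
theorem exp_neg_mul_inv_sqrt_le {c : ℝ} (hc : |c| ≤ 1 / 4) :
    Real.exp (-c) * (√(1 - 2 * c))⁻¹ ≤ Real.exp (4 * c ^ 2) := by
  have hc' := abs_le.1 hc
  have hpos : 0 < 1 - 2 * c := by linarith
  have h := Real.abs_log_sub_add_sum_range_le (x := 2 * c) (by rw [abs_mul]; norm_num; linarith) 1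
  simp only [Finset.sum_range_one, zero_add, pow_one, Nat.cast_zero, div_one] at h
  have h2 : |2 * c| ^ (1 + 1) / (1 - |2 * c|) ≤ 8 * c ^ 2 := by
    have h3 : |2 * c| ≤ 1 / 2 := by rw [abs_mul]; norm_num; linarith
    rw [div_le_iff₀ (by linarith), sq_abs]
    nlinarith [sq_nonneg c]
  have h3 := (abs_le.1 (h.trans h2)).1
  rw [Real.sqrt_eq_rpow, ← Real.rpow_neg hpos.le, Real.rpow_def_of_pos hpos, ← Real.exp_add]
  refine Real.exp_le_exp.2 ?_
  norm_num
  linarith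

theorem gaussian_sq_isCenteredSubexponential {Ω : Type*} [MeasurableSpace Ω] {P : Measure Ω}
    {X : Ω → ℝ} (hX : HasLaw X (gaussianReal 0 1) P) :
    IsCenteredSubexponential P fun ω => X ω ^ 2 - 1 := by
  have hsq : Integrable (fun x : ℝ => x ^ 2) (gaussianReal 0 1) :=
    (memLp_id_gaussianReal 2).integrable_sq
  refine ⟨?_, ?_, fun c hc => ?_⟩
  · have h : Integrable (fun x : ℝ => x ^ 2 - 1) (P.map X) := by
      rw [hX.map_eq]
      exact hsq.sub (integrable_const _)
    exact h.comp_aemeasurable hX.aemeasurable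
  · have h := hX.integral_comp (f := fun x : ℝ => x ^ 2 - 1) (by fun_prop)
    simp only [Function.comp_def] at h
    rw [h, integral_sub hsq (integrable_const _), integral_sq_gaussianReal]
    simp
  · have hc' : c < 1 / 2 := by linarith [(abs_le.1 hc).2]
    have hi := integrable_exp_mul_sq_gaussianReal hc'
    constructor
    · have h : Integrable (fun x : ℝ => Real.exp (c * (x ^ 2 - 1))) (P.map X) := by
        rwa [hX.map_eq]
      exact h.comp_aemeasurable hX.aemeasurable
    · have h := hX.integral_comp (f := fun x : ℝ => Real.exp (c * (x ^ 2 - 1))) (by fun_prop)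
      simp only [Function.comp_def] at h
      rw [h, integral_exp_mul_sq_gaussianReal hc']
      exact exp_neg_mul_inv_sqrt_le hc

/-! ### Variance, bias, and the growth of the noise levels. -/

/-- The normalized variance `σ₁⁻² ∑_{k=1}^N σ_k²` of the projection estimator. -/
def normalizedVariance (σ : ℕ → ℝ) (N : ℕ) : ℝ := 1 / σ 1 ^ 2 * ∑ i ∈ Finset.Icc 1 N, σ i ^ 2

/-- The squared bias `∑_{k > N} θ_k²` of the projection estimator. -/
def squaredBias (θ : ℕ → ℝ) (N : ℕ) : ℝ := ∑' k : ℕ, θ (N + 1 + k) ^ 2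

/-- The normalized variance at which the stochastic fluctuations are of relative order `γ`. -/
def varianceThreshold (β γ : ℝ) : ℝ := γ ^ (-(2 * (2 * β + 1)))

theorem normalizedVariance_succ (σ : ℕ → ℝ) (N : ℕ) :
    normalizedVariance σ (N + 1) = normalizedVariance σ N + σ (N + 1) ^ 2 / σ 1 ^ 2 := by
  rw [normalizedVariance, normalizedVariance, Finset.sum_Icc_succ_top (by omega)]
  ring

theorem normalizedVariance_mono (σ : ℕ → ℝ) : Monotone (normalizedVariance σ) := by
  refine monotone_nat_of_le_succ fun N => ?_
  rw [normalizedVariance_succ]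
  exact le_add_of_nonneg_right (by positivity)

theorem normalizedVariance_nonneg (σ : ℕ → ℝ) (N : ℕ) : 0 ≤ normalizedVariance σ N := by
  unfold normalizedVariance
  positivity

theorem normalizedVariance_one {σ : ℕ → ℝ} (h : 0 < σ 1 ^ 2) : normalizedVariance σ 1 = 1 := by
  rw [normalizedVariance, Finset.Icc_self, Finset.sum_singleton, one_div_mul_cancel h.ne']

theorem mul_normalizedVariance {σ : ℕ → ℝ} (h : 0 < σ 1 ^ 2) (N : ℕ) :
    σ 1 ^ 2 * normalizedVariance σ N = ∑ i ∈ Finset.Icc 1 N, σ i ^ 2 := by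
  rw [normalizedVariance, ← mul_assoc, mul_one_div_cancel h.ne', one_mul]

theorem squaredBias_nonneg (θ : ℕ → ℝ) (N : ℕ) : 0 ≤ squaredBias θ N :=
  tsum_nonneg fun _ => sq_nonneg _

theorem summable_sq_add {θ : ℕ → ℝ} (h : Summable fun k => θ k ^ 2) (N : ℕ) :
    Summable fun k => θ (N + k) ^ 2 := by
  simpa only [add_comm] using (summable_nat_add_iff N).2 h

theorem squaredBias_eq_succ {θ : ℕ → ℝ} (h : Summable fun k => θ k ^ 2) (N : ℕ) :
    squaredBias θ N = θ (N + 1) ^ 2 + squaredBias θ (N + 1) := by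
  rw [squaredBias, (summable_sq_add h (N + 1)).tsum_eq_zero_add, squaredBias]
  congr 1
  exact tsum_congr fun k => by ring_nf

theorem squaredBias_anti {θ : ℕ → ℝ} (h : Summable fun k => θ k ^ 2) :
    Antitone (squaredBias θ) := by
  refine antitone_nat_of_succ_le fun N => ?_
  rw [squaredBias_eq_succ h N]
  exact le_add_of_nonneg_left (sq_nonneg _)

theorem one_le_varianceThreshold {β γ : ℝ} (hβ : 0 ≤ β) (hγ : 0 < γ) (hγ1 : γ ≤ 1) :
    1 ≤ varianceThreshold β γ :=
  Real.one_le_rpow_of_pos_of_le_one_of_nonpos hγ hγ1 (by linarith)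

theorem varianceThreshold_rpow {β γ : ℝ} (hβ : 0 ≤ β) (hγ : 0 < γ) (s : ℝ) :
    varianceThreshold β γ ^ (-(s * (1 / (2 * β + 1)))) = γ ^ (2 * s) := by
  rw [varianceThreshold, ← Real.rpow_mul hγ.le]
  congr 1
  have : 2 * β + 1 ≠ 0 := by linarith
  field_simp

theorem mul_varianceThreshold {β γ : ℝ} (hγ : 0 < γ) :
    γ * varianceThreshold β γ = 1 / γ ^ (4 * β + 1) := by
  rw [varianceThreshold, one_div, ← Real.rpow_neg hγ.le]
  nth_rewrite 1 [← Real.rpow_one γ]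
  rw [← Real.rpow_add hγ]
  congr 1
  ring

/-- The constant `max C₂ 1` also covers k = 1, where the growth condition is silent but S(1) = 1.
The shift by B keeps the base away from 0 and lets the threshold produce factors of γ. -/
theorem PolynomialHypothesis.sq_le {β C₁ C₂ C₃ : ℝ} {σ : ℕ → ℝ}
    (h : PolynomialHypothesis β C₁ C₂ C₃ σ) (hβ : 0 ≤ β) {k : ℕ} (hk : 1 ≤ k) {B : ℝ}
    (hB : 0 ≤ B) :
    σ k ^ 2 ≤ max C₂ 1 * σ 1 ^ 2 * (normalizedVariance σ k + B) ^ (1 - 1 / (2 * β + 1)) := by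
  have hpos := h.pos
  have hb : 0 < 2 * β + 1 := by linarith
  have he : 2 * β / (2 * β + 1) = 1 - 1 / (2 * β + 1) := by field_simp; ring
  have he0 : 0 ≤ 1 - 1 / (2 * β + 1) := he ▸ by positivity
  have hC : 0 < max C₂ 1 := lt_max_of_lt_right one_pos
  rcases hk.eq_or_lt with rfl | hk'
  · have h1 : 1 ≤ (normalizedVariance σ 1 + B) ^ (1 - 1 / (2 * β + 1)) := by
      rw [normalizedVariance_one hpos]
      exact Real.one_le_rpow (by linarith) he0
    calc σ 1 ^ 2 = 1 * σ 1 ^ 2 * 1 := by ring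
      _ ≤ max C₂ 1 * σ 1 ^ 2 * (normalizedVariance σ 1 + B) ^ (1 - 1 / (2 * β + 1)) := by
        gcongr
        exact le_max_right _ _
  · refine (h.upper k hk').trans ?_
    rw [he]
    have h1 : 1 / σ 1 ^ 2 * ∑ i ∈ Finset.Icc 1 (k - 1), σ i ^ 2 ≤ normalizedVariance σ k + B :=
      (normalizedVariance_mono σ (Nat.sub_le k 1)).trans (le_add_of_nonneg_right hB)
    have h0 := normalizedVariance_nonneg σ (k - 1)
    unfold normalizedVariance at h0
    have h2 := Real.rpow_le_rpow h0 h1 he0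
    have h3 : 0 ≤ (1 / σ 1 ^ 2 * ∑ i ∈ Finset.Icc 1 (k - 1), σ i ^ 2) ^ (1 - 1 / (2 * β + 1)) := by
      positivity
    exact mul_le_mul (mul_le_mul_of_nonneg_right (le_max_left _ _) hpos.le) h2 h3 (by positivity)

/-- The noise of the sequence space model. -/
structure IsStandardNoise {Ω : Type*} [MeasurableSpace Ω] (P : Measure Ω) (ξ : ℕ → Ω → ℝ) :
    Prop where
  law : ∀ k : ℕ, 1 ≤ k → HasLaw (ξ k) (gaussianReal 0 1) P
  indep : iIndepFun (fun k : ℕ => ξ (k + 1)) P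

theorem IsStandardNoise.indep_comp {Ω : Type*} [MeasurableSpace Ω] {P : Measure Ω}
    {ξ : ℕ → Ω → ℝ} (h : IsStandardNoise P ξ) {i : ℕ → ℕ} (hi : Function.Injective i)
    (hi1 : ∀ j, 1 ≤ i j) : iIndepFun (fun j => ξ (i j)) P := by
  have hinj : Function.Injective fun j => i j - 1 := fun a b hab => hi (by
    have := hi1 a
    have := hi1 b
    simp only at hab
    omega)
  have := h.indep.precomp hinj
  have e : (fun j => ξ (i j - 1 + 1)) = fun j => ξ (i j) := by
    funext j
    rw [Nat.sub_add_cancel (hi1 j)]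
  rw [← e]
  exact this

/-! ### Fluctuation bounds uniform in the bandwidth. -/

/-- Moments of a variable with an exponential moment. -/
theorem exists_integrable_bound {r : ℝ} (hr : 0 ≤ r) {K₀ : ℝ} (hK₀ : 0 ≤ K₀) :
    ∃ K : ℝ, K₀ ≤ K ∧ 0 < K ∧ ∀ {Ω : Type*} [MeasurableSpace Ω] {P : Measure Ω}
      [IsProbabilityMeasure P]
      {M : Ω → ℝ}, (∀ ω, 0 ≤ M ω) → Integrable (fun ω => Real.exp (M ω / 2)) P →
      ∫ ω, Real.exp (M ω / 2) ∂P ≤ 4 →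
      ∃ W : Ω → ℝ, Integrable W P ∧ (∀ ω, 0 ≤ W ω) ∧ ∫ ω, W ω ∂P ≤ K ∧
        ∀ ω, 2 + M ω ^ r ≤ W ω := by
  obtain ⟨C, hC, h⟩ := exists_rpow_le_exp hr
  refine ⟨K₀ + 2 + C * 4, by linarith, by linarith, fun {Ω} _ {P} _ {M} hM0 hMi hM => ?_⟩
  -- The additive 2 leaves room for the deterministic terms, such as B, left over by the Young-type
  -- inequality.
  refine ⟨fun ω => 2 + C * Real.exp (M ω / 2), (integrable_const _).add (hMi.const_mul C),
    fun ω => by positivity, ?_, fun ω => by linarith [h (M ω) (hM0 ω)]⟩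
  rw [integral_add (integrable_const _) (hMi.const_mul C), integral_const_mul]
  simp only [integral_const, probReal_univ, smul_eq_mul, one_mul]
  linarith [mul_le_mul_of_nonneg_left hM hC.le]

/-- With q = 1/(2β+1) and x = S + B, the weights are of order τ√γ x^{1−q/4}. Since σ_k⁴ ≤ σ_k² Cτ
x^{1−q}, the squared ratios are at most increments of S times x^{-(1+q/2)}/γ, up to a constant. They
telescope to B^{-q/2}/γ = 1. The Young-type inequality then turns x^{1−q/4} γ^{-1/2} M into x + B
M^{4/q}. -/
theorem exists_chiSum_bound {β : ℝ} (hβ : 0 ≤ β) (C₂ : ℝ) :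
    ∃ K : ℝ, 0 < K ∧ ∀ {C₁ C₃ : ℝ} {Ω : Type*} [MeasurableSpace Ω] {P : Measure Ω}
      [IsProbabilityMeasure P] {ξ : ℕ → Ω → ℝ}, IsStandardNoise P ξ →
      ∀ {σ : ℕ → ℝ}, PolynomialHypothesis β C₁ C₂ C₃ σ → ∀ {γ : ℝ}, 0 < γ → γ ≤ 1 →
      ∃ W : Ω → ℝ, Integrable W P ∧ (∀ ω, 0 ≤ W ω) ∧ ∫ ω, W ω ∂P ≤ K ∧
        ∀ᵐ ω ∂P, ∀ N : ℕ, 1 ≤ N → |chiSum σ (fun k => ξ k ω) N| ≤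
          K * γ * (σ 1 ^ 2 * (normalizedVariance σ N + varianceThreshold β γ * W ω)) := by
  set q : ℝ := 1 / (2 * β + 1) with hq
  have hb : 0 < 2 * β + 1 := by linarith
  have hq0 : 0 < q := by positivity
  have hq1 : q ≤ 1 := by rw [hq, div_le_one hb]; linarith
  set C := max C₂ 1 with hC
  have hC0 : 0 < C := lt_max_of_lt_right one_pos
  set κ := √(32 * C / q) with hκ
  have hκ0 : 0 < κ := by positivity
  have hκ2 : κ ^ 2 = 32 * C / q := Real.sq_sqrt (by positivity)
  obtain ⟨K, hKκ, hK0, hK⟩ := exists_integrable_bound (r := 1 / (q / 4)) (by positivity)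
    (K₀ := 2 * κ) (by positivity)
  refine ⟨K, hK0, fun {C₁ C₃ Ω} _ {P} _ {ξ} hξ {σ} hσ {γ} hγ hγ1 => ?_⟩
  have hpos := hσ.pos
  set τ := σ 1 ^ 2 with hτ
  set B := varianceThreshold β γ with hB
  have hB1 : 1 ≤ B := one_le_varianceThreshold hβ hγ hγ1
  have hB0 : 0 < B := by linarith
  set S := normalizedVariance σ with hS
  have hx : ∀ n, 0 < S n + B := fun n => by linarith [normalizedVariance_nonneg σ n]
  have hBγ : B ^ (-(q / 2)) = γ := by
    have := varianceThreshold_rpow (s := 1 / 2) hβ hγ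
    rw [show 2 * (1 / 2 : ℝ) = 1 by norm_num, Real.rpow_one] at this
    rw [hB, ← this, hq]
    congr 2
    ring
  set w : ℕ → ℝ := fun j => τ * κ * √γ * (S (j + 1) + B) ^ (1 - q / 4) with hw
  obtain ⟨M, -, hM0, hMi, hM4, hMb⟩ := exists_bound_weighted_sums (P := P)
    (g := fun j ω => ξ (j + 1) ω ^ 2 - 1) (a := fun j => σ (j + 1) ^ 2) (w := w)
    (hξ.indep.comp (fun _ x => x ^ 2 - 1) fun _ => by fun_prop)
    (fun j => gaussian_sq_isCenteredSubexponential (hξ.law (j + 1) (by omega)))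
    (by
      intro i j hij
      have h1 : S (i + 1) ≤ S (j + 1) := normalizedVariance_mono σ (by omega)
      have h2 := hx (i + 1)
      simp only [hw]
      gcongr
      linarith)
    (by have := hx 1; simp only [hw]; positivity)
    (by
      intro n
      have hterm : ∀ j, (σ (j + 1) ^ 2 / w j) ^ 2 ≤ C / (κ ^ 2 * γ) *
          (((S (j + 1) + B) - (S j + B)) * (S (j + 1) + B) ^ (-(1 + q / 2))) := by
        intro j
        have h1 := hσ.sq_le hβ (show 1 ≤ j + 1 by omega) hB0.le
        have h2 : (S (j + 1) + B) - (S j + B) = σ (j + 1) ^ 2 / τ := by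
          rw [hS, normalizedVariance_succ]
          ring
        have hx1 := hx (j + 1)
        have h3 : (w j) ^ 2 = τ ^ 2 * κ ^ 2 * γ * (S (j + 1) + B) ^ (2 - q / 2) := by
          simp only [hw, mul_pow, Real.sq_sqrt hγ.le]
          rw [← Real.rpow_natCast ((S (j + 1) + B) ^ (1 - q / 4)), ← Real.rpow_mul hx1.le]
          congr 2
          push_cast
          ring
        have h4 : (S (j + 1) + B) ^ (1 - q) =
            (S (j + 1) + B) ^ (2 - q / 2) * (S (j + 1) + B) ^ (-(1 + q / 2)) := by
          rw [← Real.rpow_add hx1]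
          congr 1
          ring
        rw [div_pow, h3, h2, div_le_iff₀ (by positivity)]
        calc (σ (j + 1) ^ 2) ^ 2 = σ (j + 1) ^ 2 * σ (j + 1) ^ 2 := by ring
          _ ≤ σ (j + 1) ^ 2 * (C * τ * (S (j + 1) + B) ^ (1 - q)) := by gcongr
          _ = _ := by
            rw [h4]
            field_simp
      have hsum := sum_sub_mul_rpow_le (s := fun j => S j + B) (hx 0)
        (fun i j hij => by
          have : S i ≤ S j := normalizedVariance_mono σ hij
          simp only
          linarith) (half_pos hq0) n
      -- The telescoping starts at S(0) + B = B, so its value B^{-q/2} = γ cancels the γ from the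
      -- squared weights.
      have hS0 : S 0 = 0 := by simp [hS, normalizedVariance]
      rw [hS0, zero_add, hBγ] at hsum
      calc ∑ j ∈ Finset.range n, (σ (j + 1) ^ 2 / w j) ^ 2
          ≤ ∑ j ∈ Finset.range n, C / (κ ^ 2 * γ) *
            (((S (j + 1) + B) - (S j + B)) * (S (j + 1) + B) ^ (-(1 + q / 2))) :=
            Finset.sum_le_sum fun j _ => hterm j
        _ ≤ C / (κ ^ 2 * γ) * (γ / (q / 2)) := by
            rw [← Finset.mul_sum]
            exact mul_le_mul_of_nonneg_left hsum (by positivity)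
        _ = 1 / 16 := by
            rw [hκ2]
            field_simp
            norm_num)
  obtain ⟨W, hWi, hW0, hWK, hWM⟩ := hK hM0 hMi hM4
  refine ⟨W, hWi, hW0, hWK, ?_⟩
  filter_upwards [hMb] with ω hω N hN
  obtain ⟨n, rfl⟩ : ∃ n, N = n + 1 := ⟨N - 1, by omega⟩
  have h1 : chiSum σ (fun k => ξ k ω) (n + 1) =
      ∑ k ∈ Finset.range (n + 1), σ (k + 1) ^ 2 * (ξ (k + 1) ω ^ 2 - 1) := by
    rw [chiSum, Finset.range_eq_Ico, Finset.sum_Ico_add' (fun k => σ k ^ 2 * (ξ k ω ^ 2 - 1))]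
    rfl
  rw [h1]
  refine (hω n).trans ?_
  have hx1 := hx (n + 1)
  have hy := rpow_one_sub_mul_le_add hx1 (y := (√γ)⁻¹ * M ω)
    (mul_nonneg (by positivity) (hM0 ω)) (r := q / 4) (by positivity) (by linarith)
  have h2 : ((√γ)⁻¹ * M ω) ^ (1 / (q / 4)) = B * M ω ^ (1 / (q / 4)) := by
    rw [Real.mul_rpow (by positivity) (hM0 ω)]
    congr 1
    rw [Real.sqrt_eq_rpow, ← Real.rpow_neg hγ.le, ← Real.rpow_mul hγ.le, hB, varianceThreshold]
    congr 1
    rw [hq]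
    field_simp
    norm_num
  rw [h2] at hy
  have h3 : √γ = γ * (√γ)⁻¹ := by
    have : √γ ≠ 0 := by positivity
    field_simp
    exact Real.sq_sqrt hγ.le
  have h4 : 0 ≤ S (n + 1) := normalizedVariance_nonneg σ _
  have h5 : S (n + 1) + B + B * M ω ^ (1 / (q / 4)) ≤ S (n + 1) + B * W ω := by
    nlinarith [hWM ω]
  calc 2 * w n * M ω
      = 2 * κ * γ * (τ * ((S (n + 1) + B) ^ (1 - q / 4) * ((√γ)⁻¹ * M ω))) := by
        simp only [hw]
        nth_rewrite 1 [h3]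
        ring
    _ ≤ 2 * κ * γ * (τ * (S (n + 1) + B * W ω)) := by
        gcongr
        exact hy.trans h5
    _ ≤ K * γ * (τ * (S (n + 1) + B * W ω)) := by
        have := hW0 ω
        gcongr

theorem sum_range_sq_le_squaredBias {θ : ℕ → ℝ} (h : Summable fun k => θ k ^ 2) (N n : ℕ) :
    ∑ j ∈ Finset.range n, θ (N + 1 + j) ^ 2 ≤ squaredBias θ N :=
  (summable_sq_add h (N + 1)).sum_le_tsum _ fun _ _ => sq_nonneg _

/-- Beyond N₀ the squares θ_k² sum to at most T(N₀), so it suffices that the squared weights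
dominate σ_k² times the bias. The added τ keeps the weights positive when the bias vanishes. -/
theorem exists_cross_term_bound_above {β : ℝ} (hβ : 0 ≤ β) (C₂ : ℝ) :
    ∃ K : ℝ, 0 < K ∧ ∀ {C₁ C₃ : ℝ} {Ω : Type*} [MeasurableSpace Ω] {P : Measure Ω}
      [IsProbabilityMeasure P] {ξ : ℕ → Ω → ℝ}, IsStandardNoise P ξ →
      ∀ {σ : ℕ → ℝ}, PolynomialHypothesis β C₁ C₂ C₃ σ →
      ∀ {θ : ℕ → ℝ}, Summable (fun k => θ k ^ 2) → ∀ {γ : ℝ}, 0 < γ → γ ≤ 1 → ∀ N₀ : ℕ,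
      ∃ W : Ω → ℝ, Integrable W P ∧ (∀ ω, 0 ≤ W ω) ∧ ∫ ω, W ω ∂P ≤ K ∧
        ∀ᵐ ω ∂P, ∀ N : ℕ, N₀ ≤ N → |∑ k ∈ Finset.Ioc N₀ N, θ k * σ k * ξ k ω| ≤
          K * γ * (squaredBias θ N₀ +
            σ 1 ^ 2 * (normalizedVariance σ N + varianceThreshold β γ * W ω)) := by
  set q : ℝ := 1 / (2 * β + 1) with hq
  have hb : 0 < 2 * β + 1 := by linarith
  have hq0 : 0 < q := by positivity
  have hq1 : q ≤ 1 := by rw [hq, div_le_one hb]; linarith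
  set C := max C₂ 1 with hC
  have hC0 : 0 < C := lt_max_of_lt_right one_pos
  set κ := 4 * √C with hκ
  have hκ0 : 0 < κ := by positivity
  have hκ2 : κ ^ 2 = 16 * C := by rw [hκ, mul_pow, Real.sq_sqrt hC0.le]; norm_num
  obtain ⟨K, hKκ, hK0, hK⟩ := exists_integrable_bound (r := 2 * (1 / q)) (by positivity)
    (K₀ := κ) hκ0.le
  refine ⟨K, hK0, fun {C₁ C₃ Ω} _ {P} _ {ξ} hξ {σ} hσ {θ} hθ {γ} hγ hγ1 N₀ => ?_⟩
  have hpos := hσ.pos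
  set τ := σ 1 ^ 2 with hτ
  set B := varianceThreshold β γ with hB
  have hB1 : 1 ≤ B := one_le_varianceThreshold hβ hγ hγ1
  have hB0 : 0 < B := by linarith
  set S := normalizedVariance σ with hS
  have hx : ∀ n, 0 < S n + B := fun n => by linarith [normalizedVariance_nonneg σ n]
  set T := squaredBias θ N₀ with hT
  have hT0 : 0 ≤ T := squaredBias_nonneg θ N₀
  set w : ℕ → ℝ := fun j => κ * √(τ * (T + τ)) * √((S (N₀ + 1 + j) + B) ^ (1 - q)) with hw
  obtain ⟨M, -, hM0, hMi, hM4, hMb⟩ := exists_bound_weighted_sums (P := P)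
    (g := fun j => ξ (N₀ + 1 + j)) (a := fun j => θ (N₀ + 1 + j) * σ (N₀ + 1 + j)) (w := w)
    (hξ.indep_comp (add_right_injective _) fun j => by omega)
    (fun j => gaussian_isCenteredSubexponential (hξ.law _ (by omega)))
    (by
      intro i j hij
      have h1 : S (N₀ + 1 + i) ≤ S (N₀ + 1 + j) := normalizedVariance_mono σ (by omega)
      have h2 := hx (N₀ + 1 + i)
      simp only [hw]
      gcongr)
    (by have := hx (N₀ + 1); simp only [hw]; positivity)
    (by
      intro n
      have hterm : ∀ j, (θ (N₀ + 1 + j) * σ (N₀ + 1 + j) / w j) ^ 2 ≤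
          1 / (16 * (T + τ)) * θ (N₀ + 1 + j) ^ 2 := by
        intro j
        have h1 := hσ.sq_le hβ (show 1 ≤ N₀ + 1 + j by omega) hB0.le
        have hx1 := hx (N₀ + 1 + j)
        have h3 : (w j) ^ 2 = 16 * C * (τ * (T + τ)) * (S (N₀ + 1 + j) + B) ^ (1 - q) := by
          simp only [hw, mul_pow]
          rw [Real.sq_sqrt (by positivity), Real.sq_sqrt (by positivity), hκ2]
        rw [div_pow, h3, div_le_iff₀ (by positivity), mul_pow]
        calc θ (N₀ + 1 + j) ^ 2 * σ (N₀ + 1 + j) ^ 2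
            ≤ θ (N₀ + 1 + j) ^ 2 * (C * τ * (S (N₀ + 1 + j) + B) ^ (1 - q)) := by gcongr
          _ = _ := by field_simp
      calc ∑ j ∈ Finset.range n, (θ (N₀ + 1 + j) * σ (N₀ + 1 + j) / w j) ^ 2
          ≤ ∑ j ∈ Finset.range n, 1 / (16 * (T + τ)) * θ (N₀ + 1 + j) ^ 2 :=
            Finset.sum_le_sum fun j _ => hterm j
        _ ≤ 1 / (16 * (T + τ)) * (T + τ) := by
            rw [← Finset.mul_sum]
            refine mul_le_mul_of_nonneg_left ?_ (by positivity)
            exact (sum_range_sq_le_squaredBias hθ N₀ n).trans (by linarith)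
        _ = 1 / 16 := by
            have : T + τ ≠ 0 := by positivity
            field_simp)
  obtain ⟨W, hWi, hW0, hWK, hWM⟩ := hK hM0 hMi hM4
  refine ⟨W, hWi, hW0, hWK, ?_⟩
  filter_upwards [hMb] with ω hω N hN
  rcases hN.eq_or_lt with rfl | hN'
  · rw [Finset.Ioc_self, Finset.sum_empty, abs_zero]
    have := hW0 ω
    have := normalizedVariance_nonneg σ N₀
    positivity
  obtain ⟨n, rfl⟩ : ∃ n, N = N₀ + 1 + n := ⟨N - (N₀ + 1), by omega⟩
  have h1 : ∑ k ∈ Finset.Ioc N₀ (N₀ + 1 + n), θ k * σ k * ξ k ω =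
      ∑ j ∈ Finset.range (n + 1), θ (N₀ + 1 + j) * σ (N₀ + 1 + j) * ξ (N₀ + 1 + j) ω := by
    have : Finset.Ioc N₀ (N₀ + 1 + n) = Finset.Ico (N₀ + 1) (N₀ + 1 + (n + 1)) := by
      ext k
      simp only [Finset.mem_Ioc, Finset.mem_Ico]
      omega
    rw [this, Finset.sum_Ico_eq_sum_range]
    simp
  rw [h1]
  refine (hω n).trans ?_
  have hx1 := hx (N₀ + 1 + n)
  have hMω := hM0 ω
  have hy := rpow_one_sub_mul_le_add hx1 (y := (γ⁻¹ * M ω) ^ 2) (by positivity) (r := q) hq0 hq1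
  have h2 : ((γ⁻¹ * M ω) ^ 2) ^ (1 / q) = B * M ω ^ (2 * (1 / q)) := by
    rw [← Real.rpow_natCast, ← Real.rpow_mul (by positivity), Nat.cast_two,
      Real.mul_rpow (by positivity) hMω]
    congr 1
    rw [Real.inv_rpow hγ.le, ← Real.rpow_neg hγ.le, hB, varianceThreshold, hq, one_div_one_div]
  rw [h2] at hy
  set x := S (N₀ + 1 + n) with hxdef
  have h4 : 0 ≤ x := normalizedVariance_nonneg σ _
  have h5 : 1 + (x + B + B * M ω ^ (2 * (1 / q))) ≤ x + B * W ω := by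
    nlinarith [hWM ω]
  have hR0 : 0 ≤ (x + B) ^ (1 - q) := by positivity
  -- Arithmetic–geometric mean separates the bias from the noise; the factor (M/γ)² is then what the
  -- Young-type inequality converted to B M^{2/q}.
  have h6 : 2 * (√(T + τ) * (√τ * √((x + B) ^ (1 - q)) * (γ⁻¹ * M ω))) ≤
      (T + τ) + τ * ((x + B) ^ (1 - q) * (γ⁻¹ * M ω) ^ 2) := by
    have := two_mul_le_add_sq (√(T + τ)) (√τ * √((x + B) ^ (1 - q)) * (γ⁻¹ * M ω))
    rw [Real.sq_sqrt (by positivity), mul_pow, mul_pow (√τ), Real.sq_sqrt hpos.le,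
      Real.sq_sqrt hR0] at this
    linarith
  calc 2 * w n * M ω
      = κ * γ * (2 * (√(T + τ) * (√τ * √((x + B) ^ (1 - q)) * (γ⁻¹ * M ω)))) := by
        simp only [hw]
        rw [Real.sqrt_mul hpos.le, ← hxdef]
        field_simp
    _ ≤ κ * γ * (T + τ * (x + B * W ω)) := by
        gcongr
        nlinarith
    _ ≤ K * γ * (T + τ * (x + B * W ω)) := by
        have := hW0 ω
        gcongr

/-- Here the sum runs downwards from N₀, so the increasing quantity is the bias T(N). All variances
up to N₀ are at most CAγ² with A = τ(S(N₀) + B), and weights of order γA^{1/4}(A + T)^{3/4} make the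
θ_k² telescope as increments of A + T. -/
theorem exists_cross_term_bound_below {β : ℝ} (hβ : 0 ≤ β) (C₂ : ℝ) :
    ∃ K : ℝ, 0 < K ∧ ∀ {C₁ C₃ : ℝ} {Ω : Type*} [MeasurableSpace Ω] {P : Measure Ω}
      [IsProbabilityMeasure P] {ξ : ℕ → Ω → ℝ}, IsStandardNoise P ξ →
      ∀ {σ : ℕ → ℝ}, PolynomialHypothesis β C₁ C₂ C₃ σ →
      ∀ {θ : ℕ → ℝ}, Summable (fun k => θ k ^ 2) → ∀ {γ : ℝ}, 0 < γ → γ ≤ 1 → ∀ N₀ : ℕ,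
      ∃ W : Ω → ℝ, Integrable W P ∧ (∀ ω, 0 ≤ W ω) ∧ ∫ ω, W ω ∂P ≤ K ∧
        ∀ᵐ ω ∂P, ∀ N : ℕ, N ≤ N₀ → |∑ k ∈ Finset.Ioc N N₀, θ k * σ k * ξ k ω| ≤
          K * γ * (squaredBias θ N +
            σ 1 ^ 2 * (normalizedVariance σ N₀ + varianceThreshold β γ) * W ω) := by
  set q : ℝ := 1 / (2 * β + 1) with hq
  have hb : 0 < 2 * β + 1 := by linarith
  have hq0 : 0 < q := by positivity
  have hq1 : q ≤ 1 := by rw [hq, div_le_one hb]; linarith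
  set C := max C₂ 1 with hC
  have hC0 : 0 < C := lt_max_of_lt_right one_pos
  set κ := √(32 * C) with hκ
  have hκ0 : 0 < κ := by positivity
  have hκ2 : κ ^ 2 = 32 * C := Real.sq_sqrt (by positivity)
  obtain ⟨K, hKκ, hK0, hK⟩ := exists_integrable_bound (r := 1 / (1 / 4)) (by positivity)
    (K₀ := 2 * κ) (by positivity)
  refine ⟨K, hK0, fun {C₁ C₃ Ω} _ {P} _ {ξ} hξ {σ} hσ {θ} hθ {γ} hγ hγ1 N₀ => ?_⟩
  have hpos := hσ.pos
  set τ := σ 1 ^ 2 with hτ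
  set B := varianceThreshold β γ with hB
  have hB1 : 1 ≤ B := one_le_varianceThreshold hβ hγ hγ1
  have hB0 : 0 < B := by linarith
  set S := normalizedVariance σ with hS
  have hx : ∀ n, 0 < S n + B := fun n => by linarith [normalizedVariance_nonneg σ n]
  set T := squaredBias θ with hT
  have hT0 : ∀ n, 0 ≤ T n := squaredBias_nonneg θ
  have hTanti : Antitone T := squaredBias_anti hθ
  set A := τ * (S N₀ + B) with hA
  have hA0 : 0 < A := mul_pos hpos (hx N₀)
  have hAT : ∀ n, 0 < A + T n := fun n => by linarith [hT0 n]
  have hBγ : B ^ (-q) = γ ^ 2 := by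
    have := varianceThreshold_rpow (s := 1) hβ hγ
    rwa [one_mul, mul_one, Real.rpow_two] at this
  have hσA : ∀ k, 1 ≤ k → k ≤ N₀ → σ k ^ 2 ≤ C * A * γ ^ 2 := by
    intro k hk hkN
    have h1 : S k ≤ S N₀ := normalizedVariance_mono σ hkN
    have h0 := hx k
    calc σ k ^ 2 ≤ C * τ * (S k + B) ^ (1 - q) := hσ.sq_le hβ hk hB0.le
      _ ≤ C * τ * (S N₀ + B) ^ (1 - q) := by
        gcongr
      -- The factor γ² arises here: (S(N₀) + B)^{-q} ≤ B^{-q} = γ².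
      _ = C * A * (S N₀ + B) ^ (-q) := by
        rw [sub_eq_add_neg, Real.rpow_add (hx N₀), Real.rpow_one, hA]
        ring
      _ ≤ C * A * γ ^ 2 := by
        rw [← hBγ]
        refine mul_le_mul_of_nonneg_left ?_ (by positivity)
        exact Real.rpow_le_rpow_of_nonpos hB0 (by linarith [normalizedVariance_nonneg σ N₀])
          (by linarith)
  -- Time reversal of 1, …, N₀, continued injectively past N₀ so that independence holds for an
  -- infinite sequence; the continued terms get coefficient 0.
  set i : ℕ → ℕ := fun j => if j < N₀ then N₀ - j else j + 1 with hi
  have hinj : Function.Injective i := by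
    intro a b hab
    simp only [hi] at hab
    split_ifs at hab <;> omega
  have hi1 : ∀ j, 1 ≤ i j := by
    intro j
    simp only [hi]
    split_ifs <;> omega
  set a : ℕ → ℝ := fun j => if j < N₀ then θ (N₀ - j) * σ (N₀ - j) else 0 with ha
  set w : ℕ → ℝ := fun j => κ * γ * A ^ (1 / 4 : ℝ) * (A + T (N₀ - (j + 1))) ^ (1 - 1 / 4 : ℝ)
    with hw
  obtain ⟨M, -, hM0, hMi, hM4, hMb⟩ := exists_bound_weighted_sums (P := P)
    (g := fun j => ξ (i j)) (a := a) (w := w) (hξ.indep_comp hinj hi1)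
    (fun j => gaussian_isCenteredSubexponential (hξ.law _ (hi1 j)))
    (by
      intro j l hjl
      have h1 : T (N₀ - (j + 1)) ≤ T (N₀ - (l + 1)) := hTanti (by omega)
      have h2 := hAT (N₀ - (j + 1))
      simp only [hw]
      gcongr)
    (by have := hAT (N₀ - (0 + 1)); simp only [hw]; positivity)
    (by
      intro n
      have hterm : ∀ j, (a j / w j) ^ 2 ≤ C / κ ^ 2 * A ^ (1 / 2 : ℝ) *
          (((A + T (N₀ - (j + 1))) - (A + T (N₀ - j))) *
            (A + T (N₀ - (j + 1))) ^ (-(1 + 1 / 2 : ℝ))) := by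
        intro j
        by_cases hj : j < N₀
        · have h1 := hσA (N₀ - j) (by omega) (by omega)
          have h2 : (A + T (N₀ - (j + 1))) - (A + T (N₀ - j)) = θ (N₀ - j) ^ 2 := by
            have := squaredBias_eq_succ hθ (N₀ - (j + 1))
            rw [show N₀ - (j + 1) + 1 = N₀ - j by omega] at this
            rw [hT, this]
            ring
          have hx1 := hAT (N₀ - (j + 1))
          have h3 : (w j) ^ 2 = κ ^ 2 * γ ^ 2 * A ^ (1 / 2 : ℝ) *
              (A + T (N₀ - (j + 1))) ^ (1 + 1 / 2 : ℝ) := by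
            simp only [hw, mul_pow]
            rw [← Real.rpow_natCast (A ^ (1 / 4 : ℝ)), ← Real.rpow_mul hA0.le,
              ← Real.rpow_natCast ((A + T (N₀ - (j + 1))) ^ (1 - 1 / 4 : ℝ)),
              ← Real.rpow_mul hx1.le]
            norm_num
          have h4 : A = A ^ (1 / 2 : ℝ) * A ^ (1 / 2 : ℝ) := by
            rw [← Real.rpow_add hA0]
            norm_num
          simp only [ha, if_pos hj]
          rw [div_pow, h3, h2, Real.rpow_neg hx1.le, div_le_iff₀ (by positivity), mul_pow]
          calc θ (N₀ - j) ^ 2 * σ (N₀ - j) ^ 2 ≤ θ (N₀ - j) ^ 2 * (C * A * γ ^ 2) := by gcongr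
            _ = _ := by
              nth_rewrite 1 [h4]
              field_simp
        · have h1 : N₀ - (j + 1) = N₀ - j := by omega
          simp [ha, hj, h1]
      have hsum := sum_sub_mul_rpow_le (s := fun j => A + T (N₀ - j)) (hAT _)
        (fun j l hjl => by
          have : T (N₀ - j) ≤ T (N₀ - l) := hTanti (by omega)
          simp only
          linarith) (one_half_pos (α := ℝ)) n
      have h0 : (A + T (N₀ - 0)) ^ (-(1 / 2) : ℝ) ≤ A ^ (-(1 / 2) : ℝ) :=
        Real.rpow_le_rpow_of_nonpos hA0 (by linarith [hT0 (N₀ - 0)]) (by norm_num)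
      calc ∑ j ∈ Finset.range n, (a j / w j) ^ 2
          ≤ ∑ j ∈ Finset.range n, C / κ ^ 2 * A ^ (1 / 2 : ℝ) *
          (((A + T (N₀ - (j + 1))) - (A + T (N₀ - j))) *
            (A + T (N₀ - (j + 1))) ^ (-(1 + 1 / 2 : ℝ))) :=
            Finset.sum_le_sum fun j _ => hterm j
        _ ≤ C / κ ^ 2 * A ^ (1 / 2 : ℝ) * (A ^ (-(1 / 2) : ℝ) / (1 / 2)) := by
            rw [← Finset.mul_sum]
            refine mul_le_mul_of_nonneg_left (hsum.trans ?_) (by positivity)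
            gcongr
        _ = 1 / 16 := by
            rw [hκ2, Real.rpow_neg hA0.le]
            field_simp
            norm_num)
  obtain ⟨W, hWi, hW0, hWK, hWM⟩ := hK hM0 hMi hM4
  refine ⟨W, hWi, hW0, hWK, ?_⟩
  filter_upwards [hMb] with ω hω N hN
  rcases hN.eq_or_lt with rfl | hN'
  · rw [Finset.Ioc_self, Finset.sum_empty, abs_zero]
    have := hW0 ω
    have := hT0 N
    have := hx N
    positivity
  obtain ⟨n, hn⟩ : ∃ n, N₀ = N + (n + 1) := ⟨N₀ - (N + 1), by omega⟩
  have h1 : ∑ k ∈ Finset.Ioc N N₀, θ k * σ k * ξ k ω =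
      ∑ j ∈ Finset.range (n + 1), a j * ξ (i j) ω := by
    refine Finset.sum_nbij' (fun k => N₀ - k) (fun j => N₀ - j) ?_ ?_ ?_ ?_ ?_
    · intro k hk
      rw [Finset.mem_Ioc] at hk
      rw [Finset.mem_range]
      omega
    · intro j hj
      rw [Finset.mem_range] at hj
      rw [Finset.mem_Ioc]
      omega
    · intro k hk
      rw [Finset.mem_Ioc] at hk
      omega
    · intro j hj
      rw [Finset.mem_range] at hj
      omega
    · intro k hk
      rw [Finset.mem_Ioc] at hk
      have e1 : N₀ - k < N₀ := by omega
      have e2 : N₀ - (N₀ - k) = k := by omega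
      simp only [ha, hi, if_pos e1, e2]
  rw [h1]
  refine (hω n).trans ?_
  have hwn : N₀ - (n + 1) = N := by omega
  have hMω := hM0 ω
  have hy := rpow_one_sub_mul_le_add (hAT N) (y := A ^ (1 / 4 : ℝ) * M ω) (by positivity)
    (r := 1 / 4) (by norm_num) (by norm_num)
  have h2 : (A ^ (1 / 4 : ℝ) * M ω) ^ (1 / (1 / 4) : ℝ) = A * M ω ^ (1 / (1 / 4) : ℝ) := by
    rw [Real.mul_rpow (by positivity) hMω, ← Real.rpow_mul hA0.le]
    norm_num
  rw [h2] at hy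
  have h5 : A + T N + A * M ω ^ (1 / (1 / 4) : ℝ) ≤ T N + A * W ω := by
    nlinarith [hWM ω]
  calc 2 * w n * M ω
      = 2 * κ * γ * ((A + T N) ^ (1 - 1 / 4 : ℝ) * (A ^ (1 / 4 : ℝ) * M ω)) := by
        simp only [hw, hwn]
        ring
    _ ≤ 2 * κ * γ * (T N + A * W ω) := by
        gcongr
        exact hy.trans h5
    _ ≤ K * γ * (T N + A * W ω) := by
        have := hW0 ω
        have := hT0 N
        gcongr

/-! ### Divergence of the variance; exact formulas for the loss and the empirical risk. -/

theorem normalizedVariance_eq_sum_range (σ : ℕ → ℝ) (N : ℕ) :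
    normalizedVariance σ N = ∑ k ∈ Finset.range N, σ (k + 1) ^ 2 / σ 1 ^ 2 := by
  induction N with
  | zero => simp [normalizedVariance]
  | succ N ih => rw [normalizedVariance_succ, Finset.sum_range_succ, ih]

/-- Keeping only i = 1 in the lower condition gives σ_k² ≥ C₁σ₁²/(2k), and the harmonic series
diverges. This forces the empirical risk to infinity, hence the existence of a minimizer. -/
theorem PolynomialHypothesis.tendsto_normalizedVariance {β C₁ C₂ C₃ : ℝ} {σ : ℕ → ℝ}
    (h : PolynomialHypothesis β C₁ C₂ C₃ σ) (hC₁ : 0 < C₁) :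
    Filter.Tendsto (normalizedVariance σ) Filter.atTop Filter.atTop := by
  have hpos := h.pos
  have e : normalizedVariance σ = fun N => ∑ k ∈ Finset.range N, σ (k + 1) ^ 2 / σ 1 ^ 2 :=
    funext (normalizedVariance_eq_sum_range σ)
  rw [e, ← not_summable_iff_tendsto_nat_atTop_of_nonneg fun k => by positivity]
  intro hs
  have h1 : Summable fun k : ℕ => C₁ / 2 * (1 / ((k + 2 : ℕ) : ℝ)) := by
    refine Summable.of_nonneg_of_le (fun k => by positivity) (fun k => ?_)
      ((summable_nat_add_iff 1).2 hs)
    have h2 := h.lower (k + 2) (by omega)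
    have hk : (1 : ℝ) ≤ 2 * ((k + 2 : ℕ) : ℝ) := by
      push_cast
      linarith [(k.cast_nonneg : (0 : ℝ) ≤ k)]
    have h3 : σ 1 ^ 2 / (2 * ((k + 2 : ℕ) : ℝ)) ≤
        √(1 / (2 * ((k + 2 : ℕ) : ℝ)) * ∑ i ∈ Finset.Icc 1 (2 * (k + 2)), σ i ^ 4) := by
      refine Real.le_sqrt_of_sq_le ?_
      have h4 : σ 1 ^ 4 ≤ ∑ i ∈ Finset.Icc 1 (2 * (k + 2)), σ i ^ 4 :=
        Finset.single_le_sum (f := fun i => σ i ^ 4) (fun i _ => by positivity)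
          (Finset.mem_Icc.2 ⟨le_rfl, by omega⟩)
      calc (σ 1 ^ 2 / (2 * ((k + 2 : ℕ) : ℝ))) ^ 2
          = 1 / (2 * ((k + 2 : ℕ) : ℝ)) * σ 1 ^ 4 / (2 * ((k + 2 : ℕ) : ℝ)) := by
            field_simp
        _ ≤ 1 / (2 * ((k + 2 : ℕ) : ℝ)) * σ 1 ^ 4 := div_le_self (by positivity) hk
        _ ≤ _ := by gcongr
    have h5 := (mul_le_mul_of_nonneg_left h3 hC₁.le).trans h2
    rw [le_div_iff₀ hpos]
    refine le_trans (le_of_eq ?_) h5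
    field_simp
  have h2 : Summable fun k : ℕ => 1 / ((k + 2 : ℕ) : ℝ) :=
    (summable_mul_left_iff (by positivity)).1 h1
  exact Real.not_summable_one_div_natCast ((summable_nat_add_iff 2).1 h2)

theorem sum_sq_eq_squaredBias_sub {θ : ℕ → ℝ} (h : Summable fun k => θ k ^ 2) (N : ℕ) :
    ∑ k ∈ Finset.Icc 1 N, θ k ^ 2 = squaredBias θ 0 - squaredBias θ N := by
  induction N with
  | zero => simp
  | succ N ih =>
    rw [Finset.sum_Icc_succ_top (by omega), ih, squaredBias_eq_succ h N]
    ring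

theorem sqDist_projectionEstimator {θ : ℕ → ℝ} (h : Summable fun k => θ k ^ 2) (σ x : ℕ → ℝ)
    (N : ℕ) : sqDist (projectionEstimator (observation θ σ x) N) θ =
      squaredBias θ N + ∑ k ∈ Finset.Icc 1 N, σ k ^ 2 + chiSum σ x N := by
  set f : ℕ → ℝ := fun k =>
    (projectionEstimator (observation θ σ x) N (k + 1) - θ (k + 1)) ^ 2 with hf
  have htail : (fun k => f (k + N)) = fun k => θ (N + 1 + k) ^ 2 := by
    funext k
    have : ¬ k + N + 1 ≤ N := by omega
    simp only [hf, projectionEstimator, if_neg this, zero_sub, neg_sq]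
    congr 2
    omega
  have hs : Summable f := by
    rw [← summable_nat_add_iff N, htail]
    exact summable_sq_add h (N + 1)
  have h1 := hs.sum_add_tsum_nat_add N
  have h2 : ∑ k ∈ Finset.range N, f k = ∑ k ∈ Finset.Icc 1 N, σ k ^ 2 * x k ^ 2 := by
    have e : Finset.Icc 1 N = Finset.Ico (0 + 1) (N + 1) := rfl
    rw [e, ← Finset.sum_Ico_add' (fun k => σ k ^ 2 * x k ^ 2), Finset.range_eq_Ico]
    refine Finset.sum_congr rfl fun k hk => ?_
    have : k + 1 ≤ N := by
      have := (Finset.mem_Ico.1 hk).2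
      omega
    simp only [hf, projectionEstimator, if_pos this, observation]
    ring
  have h3 : ∑' k, f (k + N) = squaredBias θ N := by rw [htail]; rfl
  rw [h2, h3] at h1
  rw [sqDist, ← h1, chiSum]
  simp only [mul_sub, Finset.sum_sub_distrib, mul_one]
  ring

/-- The last term does not depend on N, so it cancels when two bandwidths are compared. -/
theorem empiricalRisk_eq {θ : ℕ → ℝ} (h : Summable fun k => θ k ^ 2) (σ x U : ℕ → ℝ) (α : ℝ)
    (N : ℕ) : empiricalRisk σ (penalty σ U α) (observation θ σ x) N =
      rhmRisk θ σ U α N - chiSum σ x N - 2 * ∑ k ∈ Finset.Icc 1 N, θ k * σ k * x k -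
        squaredBias θ 0 := by
  have h1 : ∑ k ∈ Finset.Icc 1 N, observation θ σ x k ^ 2 = ∑ k ∈ Finset.Icc 1 N, θ k ^ 2 +
      2 * ∑ k ∈ Finset.Icc 1 N, θ k * σ k * x k + ∑ k ∈ Finset.Icc 1 N, σ k ^ 2 * x k ^ 2 := by
    rw [Finset.mul_sum, ← Finset.sum_add_distrib, ← Finset.sum_add_distrib]
    refine Finset.sum_congr rfl fun k _ => ?_
    rw [observation]
    ring
  have h2 : rhmRisk θ σ U α N =
      squaredBias θ N + ∑ k ∈ Finset.Icc 1 N, σ k ^ 2 + (1 + α) * U N := rfl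
  rw [empiricalRisk, penalty, h1, h2, sum_sq_eq_squaredBias_sub h, chiSum]
  simp only [mul_sub, Finset.sum_sub_distrib, mul_one]
  ring

theorem sum_Icc_sub_sum_Icc {f : ℕ → ℝ} {m n : ℕ} (h : m ≤ n) :
    ∑ k ∈ Finset.Icc 1 n, f k - ∑ k ∈ Finset.Icc 1 m, f k = ∑ k ∈ Finset.Ioc m n, f k := by
  have e : ∀ n, Finset.Icc 1 n = Finset.Ioc 0 n := fun n => rfl
  rw [e, e, ← Finset.sum_Ioc_consecutive f m.zero_le h, add_sub_cancel_left]

theorem U0_nonneg {Ω : Type*} [MeasurableSpace Ω] (P : Measure Ω) (σ : ℕ → ℝ)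
    (ξ : ℕ → Ω → ℝ) (N : ℕ) : 0 ≤ U0 P σ ξ N :=
  Real.sInf_nonneg fun _ ht => ht.1.le

/-! ### From the fluctuation bounds to the oracle inequality. -/

/-- The constants of the fluctuation bounds are combined into the risk bound. -/
theorem loss_le_of_fluctuations_le {t s t₀ s₀ b u r₀ η η₀ δ w₁ w₂ w₃ : ℝ} (ht : 0 ≤ t)
    (hs : 0 ≤ s) (hu : 0 ≤ u) (hu6 : u ≤ 1 / 6) (hη : η ≤ u * (s + b * w₁))
    (hδ : δ ≤ u * (t₀ + s + b * w₂) + u * (t + (s₀ + b) * w₃))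
    (hmin : t + s ≤ r₀ + η - η₀ + 2 * δ) :
    t + s + η ≤ (1 + 8 * u) * (r₀ - η₀ + u * (b * w₁ + 2 * t₀ + 2 * (b * w₂) +
      2 * ((s₀ + b) * w₃))) + u * (b * w₁) := by
  set D := r₀ - η₀ + u * (b * w₁ + 2 * t₀ + 2 * (b * w₂) + 2 * ((s₀ + b) * w₃)) with hD
  have hut : 0 ≤ u * t := mul_nonneg hu ht
  have h1 : (1 - 3 * u) * (t + s) ≤ D := by
    rw [hD]
    linarith
  have h2 : (1 + 8 * u) * ((1 - 3 * u) * (t + s)) ≤ (1 + 8 * u) * D :=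
    mul_le_mul_of_nonneg_left h1 (by linarith)
  -- The surplus is 4u − 24u², nonnegative exactly because 0 ≤ u ≤ 1/6. The extra u on the left pays
  -- for the u s contained in η.
  have h3 : 1 + u ≤ (1 + 8 * u) * (1 - 3 * u) := by nlinarith
  have h4 : (1 + u) * (t + s) ≤ (1 + 8 * u) * (1 - 3 * u) * (t + s) :=
    mul_le_mul_of_nonneg_right h3 (by linarith)
  linarith

theorem integrable_chiSum {Ω : Type*} [MeasurableSpace Ω] {P : Measure Ω} {ξ : ℕ → Ω → ℝ}
    (hξ : IsStandardNoise P ξ) (σ : ℕ → ℝ) (N : ℕ) :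
    Integrable (fun ω => chiSum σ (fun k => ξ k ω) N) P :=
  integrable_finsetSum _ fun k hk =>
    (gaussian_sq_isCenteredSubexponential (hξ.law k (Finset.mem_Icc.1 hk).1)).integrable.const_mul _

theorem integral_chiSum {Ω : Type*} [MeasurableSpace Ω] {P : Measure Ω} {ξ : ℕ → Ω → ℝ}
    (hξ : IsStandardNoise P ξ) (σ : ℕ → ℝ) (N : ℕ) :
    ∫ ω, chiSum σ (fun k => ξ k ω) N ∂P = 0 := by
  unfold chiSum
  rw [integral_finsetSum _ fun k hk => (gaussian_sq_isCenteredSubexponential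
    (hξ.law k (Finset.mem_Icc.1 hk).1)).integrable.const_mul _]
  refine Finset.sum_eq_zero fun k hk => ?_
  rw [integral_const_mul,
    (gaussian_sq_isCenteredSubexponential (hξ.law k (Finset.mem_Icc.1 hk).1)).mean, mul_zero]

/-- The bandwidth takes countably many values, so evaluating the loss process at it is jointly
measurable. -/
theorem aestronglyMeasurable_sqDist {Ω : Type*} [MeasurableSpace Ω] {P : Measure Ω}
    {ξ : ℕ → Ω → ℝ} (hξ : IsStandardNoise P ξ) (σ : ℕ → ℝ) {θ : ℕ → ℝ}
    (hθ : Summable fun k => θ k ^ 2) {N : Ω → ℕ} (hN : AEMeasurable N P) :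
    AEStronglyMeasurable (fun ω => sqDist
      (projectionEstimator (observation θ σ (fun k => ξ k ω)) (N ω)) θ) P := by
  have h1 : AEMeasurable (fun ω => (N ω, fun n => chiSum σ (fun k => ξ k ω) n)) P :=
    hN.prodMk (aemeasurable_pi_lambda _ fun n => (integrable_chiSum hξ σ n).aemeasurable)
  have h2 : Measurable fun p : ℕ × (ℕ → ℝ) =>
      squaredBias θ p.1 + ∑ k ∈ Finset.Icc 1 p.1, σ k ^ 2 + p.2 p.1 :=
    measurable_from_prod_countable_right fun n => by
      simp only
      fun_prop
  refine (h2.comp_aemeasurable h1).aestronglyMeasurable.congr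
    (Filter.Eventually.of_forall fun ω => ?_)
  simp only [sqDist_projectionEstimator hθ, Function.comp_apply]

/-- The bandwidths exist almost surely, and the squared risk is bounded by the penalized risk
at any fixed `N₀`. -/
theorem exists_risk_bound {β : ℝ} (hβ : 0 ≤ β) {C₁ : ℝ} (hC₁ : 0 < C₁) (C₂ : ℝ) :
    ∃ K : ℝ, 0 < K ∧ ∀ {C₃ : ℝ} {Ω : Type*} [MeasurableSpace Ω] {P : Measure Ω}
      [IsProbabilityMeasure P] {ξ : ℕ → Ω → ℝ}, IsStandardNoise P ξ →
      ∀ {σ : ℕ → ℝ}, PolynomialHypothesis β C₁ C₂ C₃ σ →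
      ∀ {θ : ℕ → ℝ}, Summable (fun k => θ k ^ 2) →
      ∀ {γ : ℝ}, 0 < γ → γ ≤ 1 → K * γ ≤ 1 / 6 → ∀ {α : ℝ}, 0 ≤ 1 + α →
      ∀ {U : ℕ → ℝ}, (∀ N, 0 ≤ U N) →
        (∀ᵐ ω ∂P, ∃ N : ℕ, IsBandwidth σ (penalty σ U α)
          (observation θ σ (fun k => ξ k ω)) N) ∧
        ∀ N : Ω → ℕ, AEMeasurable N P →
          (∀ᵐ ω ∂P, IsBandwidth σ (penalty σ U α)
            (observation θ σ (fun k => ξ k ω)) (N ω)) →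
          Integrable (fun ω => sqDist
            (projectionEstimator (observation θ σ (fun k => ξ k ω)) (N ω)) θ) P ∧
          ∀ N₀ : ℕ, 1 ≤ N₀ → ∫ ω, sqDist
              (projectionEstimator (observation θ σ (fun k => ξ k ω)) (N ω)) θ ∂P ≤
            (1 + (14 + 6 * K) * (K * γ)) * rhmRisk θ σ U α N₀ +
              16 * K * (K * γ) * (σ 1 ^ 2 * varianceThreshold β γ) := by
  obtain ⟨K₁, hK₁, H₁⟩ := exists_chiSum_bound hβ C₂
  obtain ⟨K₂, hK₂, H₂⟩ := exists_cross_term_bound_above hβ C₂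
  obtain ⟨K₃, hK₃, H₃⟩ := exists_cross_term_bound_below hβ C₂
  set K := max K₁ (max K₂ K₃) with hKdef
  have hK1 : K₁ ≤ K := le_max_left _ _
  have hK2 : K₂ ≤ K := (le_max_left _ _).trans (le_max_right _ _)
  have hK3 : K₃ ≤ K := (le_max_right _ _).trans (le_max_right _ _)
  have hK0 : 0 < K := hK₁.trans_le hK1
  refine ⟨K, hK0, fun {C₃ Ω} _ {P} _ {ξ} hξ {σ} hσ {θ} hθ {γ} hγ hγ1 hu6 {α} hα {U} hU => ?_⟩
  have hpos := hσ.pos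
  set u := K * γ with hu
  have hu0 : 0 < u := mul_pos hK0 hγ
  have hu₁ : K₁ * γ ≤ u := mul_le_mul_of_nonneg_right hK1 hγ.le
  have hu₂ : K₂ * γ ≤ u := mul_le_mul_of_nonneg_right hK2 hγ.le
  have hu₃ : K₃ * γ ≤ u := mul_le_mul_of_nonneg_right hK3 hγ.le
  set S := normalizedVariance σ with hS
  set T := squaredBias θ with hT
  set B := varianceThreshold β γ with hB
  have hB0 : 0 < B := by linarith [one_le_varianceThreshold hβ hγ hγ1]
  have hS0 : ∀ n, 0 ≤ S n := normalizedVariance_nonneg σ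
  have hT0 : ∀ n, 0 ≤ T n := squaredBias_nonneg θ
  have hτS : ∀ n, σ 1 ^ 2 * S n = ∑ i ∈ Finset.Icc 1 n, σ i ^ 2 := mul_normalizedVariance hpos
  have hR : ∀ n, rhmRisk θ σ U α n = T n + σ 1 ^ 2 * S n + (1 + α) * U n := fun n => by
    rw [hτS]; rfl
  have hαU : ∀ n, 0 ≤ (1 + α) * U n := fun n => mul_nonneg hα (hU n)
  obtain ⟨W₁, hWi₁, hW0₁, hWK₁, hWb₁⟩ := H₁ hξ hσ hγ hγ1
  constructor
  · obtain ⟨W₂, -, hW0₂, -, hWb₂⟩ := H₂ hξ hσ hθ hγ hγ1 1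
    filter_upwards [hWb₁, hWb₂] with ω h₁ h₂
    set y := observation θ σ (fun k => ξ k ω) with hy
    set X : ℕ → ℝ := fun n => ∑ k ∈ Finset.Icc 1 n, θ k * σ k * ξ k ω with hX
    set c := u * (σ 1 ^ 2 * (B * W₁ ω)) + 2 * (u * (T 1 + σ 1 ^ 2 * (B * W₂ ω))) +
      2 * X 1 + T 0 with hc
    -- The fluctuations cost at most 3u ≤ 1/2 of the variance (u from η and 2u from the cross term),
    -- so half of it survives and drives the empirical risk to infinity.
    have hlow : ∀ n, σ 1 ^ 2 / 2 * S (n + 1) - c ≤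
        empiricalRisk σ (penalty σ U α) y (n + 1) := by
      intro n
      have e := empiricalRisk_eq hθ σ (fun k => ξ k ω) U α (n + 1)
      have g₁ := (le_abs_self _).trans (h₁ (n + 1) (by omega))
      have g₂ := (le_abs_self _).trans (h₂ (n + 1) (by omega))
      rw [← sum_Icc_sub_sum_Icc (by omega)] at g₂
      have q₁ : K₁ * γ * (σ 1 ^ 2 * (S (n + 1) + B * W₁ ω)) ≤
          u * (σ 1 ^ 2 * (S (n + 1) + B * W₁ ω)) := by
        have := hS0 (n + 1)
        have := hW0₁ ω
        gcongr
      have q₂ : K₂ * γ * (T 1 + σ 1 ^ 2 * (S (n + 1) + B * W₂ ω)) ≤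
          u * (T 1 + σ 1 ^ 2 * (S (n + 1) + B * W₂ ω)) := by
        have := hS0 (n + 1)
        have := hW0₂ ω
        have := hT0 1
        gcongr
      rw [e, hR]
      have hs : 0 ≤ σ 1 ^ 2 * S (n + 1) := mul_nonneg hpos.le (hS0 _)
      have hus : u * (σ 1 ^ 2 * S (n + 1)) ≤ 1 / 6 * (σ 1 ^ 2 * S (n + 1)) :=
        mul_le_mul_of_nonneg_right hu6 hs
      have := hT0 (n + 1)
      have := hαU (n + 1)
      have q₁' := g₁.trans q₁
      have q₂' := g₂.trans q₂
      simp only [hc, hX]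
      linarith
    have hlim : Filter.Tendsto (fun n => empiricalRisk σ (penalty σ U α) y (n + 1))
        Filter.cofinite Filter.atTop := by
      rw [Nat.cofinite_eq_atTop]
      refine Filter.tendsto_atTop_mono hlow ?_
      refine Filter.tendsto_atTop_add_const_right _ (-c) ?_
      exact ((hσ.tendsto_normalizedVariance hC₁).comp (Filter.tendsto_add_atTop_nat 1)).const_mul_atTop
        (by positivity)
    obtain ⟨n, hn⟩ := hlim.exists_forall_le
    refine ⟨n + 1, by omega, fun m hm => ?_⟩
    have := hn (m - 1)
    rwa [Nat.sub_add_cancel hm] at this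
  · intro N hNm hN
    have key : ∀ N₀ : ℕ, 1 ≤ N₀ → Integrable (fun ω => sqDist
            (projectionEstimator (observation θ σ (fun k => ξ k ω)) (N ω)) θ) P ∧
        ∫ ω, sqDist (projectionEstimator (observation θ σ (fun k => ξ k ω)) (N ω)) θ ∂P ≤
          (1 + (14 + 6 * K) * u) * rhmRisk θ σ U α N₀ + 16 * K * u * (σ 1 ^ 2 * B) := by
      intro N₀ hN₀
      -- These factors depend on N₀, so the bound is integrated for each fixed N₀ and the infimum is
      -- taken only after expectation.
      obtain ⟨W₂, hWi₂, hW0₂, hWK₂, hWb₂⟩ := H₂ hξ hσ hθ hγ hγ1 N₀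
      obtain ⟨W₃, hWi₃, hW0₃, hWK₃, hWb₃⟩ := H₃ hξ hσ hθ hγ hγ1 N₀
      set b := σ 1 ^ 2 * B with hb
      have hb0 : 0 < b := mul_pos hpos hB0
      set s₀ := σ 1 ^ 2 * S N₀ with hs₀
      have hs₀0 : 0 ≤ s₀ := mul_nonneg hpos.le (hS0 _)
      set r₀ := rhmRisk θ σ U α N₀ with hr₀
      have hr₀le : T N₀ + s₀ ≤ r₀ := by
        rw [hr₀, hR]
        linarith [hαU N₀]
      have hchi := integrable_chiSum hξ σ N₀
      set F : Ω → ℝ := fun ω => (1 + 8 * u) * (r₀ - chiSum σ (fun k => ξ k ω) N₀ +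
        u * (b * W₁ ω + 2 * T N₀ + 2 * (b * W₂ ω) + 2 * ((s₀ + b) * W₃ ω))) + u * (b * W₁ ω)
        with hF
      have hG₁ : Integrable (fun ω => r₀ - chiSum σ (fun k => ξ k ω) N₀) P :=
        (integrable_const _).sub hchi
      have hG₂ : Integrable (fun ω => b * W₁ ω + 2 * T N₀) P :=
        (hWi₁.const_mul b).add (integrable_const _)
      have hG₃ : Integrable (fun ω => b * W₁ ω + 2 * T N₀ + 2 * (b * W₂ ω)) P :=
        hG₂.add ((hWi₂.const_mul b).const_mul 2)
      have hG₄ : Integrable (fun ω => b * W₁ ω + 2 * T N₀ + 2 * (b * W₂ ω) +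
          2 * ((s₀ + b) * W₃ ω)) P := hG₃.add ((hWi₃.const_mul (s₀ + b)).const_mul 2)
      have hG₅ : Integrable (fun ω => r₀ - chiSum σ (fun k => ξ k ω) N₀ +
        u * (b * W₁ ω + 2 * T N₀ + 2 * (b * W₂ ω) + 2 * ((s₀ + b) * W₃ ω))) P :=
        hG₁.add (hG₄.const_mul u)
      have hG₆ : Integrable (fun ω => u * (b * W₁ ω)) P := (hWi₁.const_mul b).const_mul u
      have hFi : Integrable F P := (hG₅.const_mul _).add hG₆
      have hFint : ∫ ω, F ω ∂P = (1 + 8 * u) * (r₀ + u * (b * ∫ ω, W₁ ω ∂P + 2 * T N₀ +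
          2 * (b * ∫ ω, W₂ ω ∂P) + 2 * ((s₀ + b) * ∫ ω, W₃ ω ∂P))) +
          u * (b * ∫ ω, W₁ ω ∂P) := by
        simp only [hF]
        rw [integral_add (hG₅.const_mul _) hG₆, integral_const_mul,
          integral_add hG₁ (hG₄.const_mul u), integral_sub (integrable_const _) hchi,
          integral_chiSum hξ, integral_const_mul,
          integral_add hG₃ ((hWi₃.const_mul (s₀ + b)).const_mul 2),
          integral_add hG₂ ((hWi₂.const_mul b).const_mul 2),
          integral_add (hWi₁.const_mul b) (integrable_const _)]
        simp only [integral_const_mul, integral_const, probReal_univ, smul_eq_mul, one_mul,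
          sub_zero]
      have hpath : ∀ᵐ ω ∂P, 0 ≤ sqDist
          (projectionEstimator (observation θ σ (fun k => ξ k ω)) (N ω)) θ ∧
          sqDist (projectionEstimator (observation θ σ (fun k => ξ k ω)) (N ω)) θ ≤ F ω := by
        filter_upwards [hWb₁, hWb₂, hWb₃, hN] with ω h₁ h₂ h₃ hω
        refine ⟨tsum_nonneg fun _ => sq_nonneg _, ?_⟩
        have hmin := hω.2 N₀ hN₀
        rw [empiricalRisk_eq hθ, empiricalRisk_eq hθ, hR (N ω)] at hmin
        rw [sqDist_projectionEstimator hθ, ← hτS]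
        set n := N ω with hn
        have hs : 0 ≤ σ 1 ^ 2 * S n := mul_nonneg hpos.le (hS0 _)
        have w₁ := hW0₁ ω
        have w₂ := hW0₂ ω
        have w₃ := hW0₃ ω
        have t0 := hT0 n
        have t1 := hT0 N₀
        have s1 := hS0 n
        have s2 := hS0 N₀
        set X : ℕ → ℝ := fun n => ∑ k ∈ Finset.Icc 1 n, θ k * σ k * ξ k ω with hX
        have p₁ : 0 ≤ u * (T N₀ + σ 1 ^ 2 * S n + b * W₂ ω) := by positivity
        have p₂ : 0 ≤ u * (T n + (s₀ + b) * W₃ ω) := by positivity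
        refine loss_le_of_fluctuations_le (δ := X n - X N₀) t0 hs hu0.le hu6 ?_ ?_ ?_
        · refine (le_abs_self _).trans ((h₁ n hω.1).trans ?_)
          calc K₁ * γ * (σ 1 ^ 2 * (S n + B * W₁ ω)) ≤ u * (σ 1 ^ 2 * (S n + B * W₁ ω)) := by
                gcongr
            _ = _ := by rw [hb]; ring
        -- Only one of the two cross-term bounds applies, according to the side of N₀; adding the
        -- other, which is nonnegative, gives a common bound.
        · rcases le_total N₀ n with hle | hle
          · have g := (le_abs_self _).trans (h₂ n hle)
            rw [← sum_Icc_sub_sum_Icc hle] at g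
            have g' : K₂ * γ * (T N₀ + σ 1 ^ 2 * (S n + B * W₂ ω)) ≤
                u * (T N₀ + σ 1 ^ 2 * S n + b * W₂ ω) := by
              calc _ ≤ u * (T N₀ + σ 1 ^ 2 * (S n + B * W₂ ω)) := by gcongr
                _ = _ := by rw [hb]; ring
            exact (g.trans g').trans (le_add_of_nonneg_right p₂)
          · have g := (neg_le_abs _).trans (h₃ n hle)
            rw [← sum_Icc_sub_sum_Icc hle, neg_sub] at g
            have g' : K₃ * γ * (T n + σ 1 ^ 2 * (S N₀ + B) * W₃ ω) ≤
                u * (T n + (s₀ + b) * W₃ ω) := by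
              calc _ ≤ u * (T n + σ 1 ^ 2 * (S N₀ + B) * W₃ ω) := by gcongr
                _ = _ := by rw [hb, hs₀]; ring
            exact (g.trans g').trans (le_add_of_nonneg_left p₁)
        · have := hαU n
          simp only [hX]
          linarith
      have hint : Integrable (fun ω => sqDist
          (projectionEstimator (observation θ σ (fun k => ξ k ω)) (N ω)) θ) P := by
        refine hFi.mono' (aestronglyMeasurable_sqDist hξ σ hθ hNm) (hpath.mono fun ω hω => ?_)
        rw [Real.norm_of_nonneg hω.1]
        exact hω.2
      refine ⟨hint, (integral_mono_ae hint hFi (hpath.mono fun ω hω => hω.2)).trans ?_⟩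
      rw [hFint]
      have t1 := hT0 N₀
      have hr0 : 0 ≤ r₀ := by linarith
      have i₁ : b * ∫ ω, W₁ ω ∂P ≤ b * K := mul_le_mul_of_nonneg_left (hWK₁.trans hK1) hb0.le
      have i₂ : b * ∫ ω, W₂ ω ∂P ≤ b * K := mul_le_mul_of_nonneg_left (hWK₂.trans hK2) hb0.le
      have i₃ : (s₀ + b) * ∫ ω, W₃ ω ∂P ≤ (s₀ + b) * K :=
        mul_le_mul_of_nonneg_left (hWK₃.trans hK3) (by positivity)
      have hsK : s₀ * K ≤ r₀ * K := mul_le_mul_of_nonneg_right (by linarith) hK0.le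
      have i₄ : u * (b * ∫ ω, W₁ ω ∂P + 2 * T N₀ +
          2 * (b * ∫ ω, W₂ ω ∂P) + 2 * ((s₀ + b) * ∫ ω, W₃ ω ∂P)) ≤
          u * ((2 + 2 * K) * r₀ + 5 * (b * K)) :=
        mul_le_mul_of_nonneg_left (by linarith) hu0.le
      have i₅ : u * (b * ∫ ω, W₁ ω ∂P) ≤ u * (b * K) := mul_le_mul_of_nonneg_left i₁ hu0.le
      have i₆ : (1 + 8 * u) * (r₀ + u * (b * ∫ ω, W₁ ω ∂P + 2 * T N₀ +
          2 * (b * ∫ ω, W₂ ω ∂P) + 2 * ((s₀ + b) * ∫ ω, W₃ ω ∂P))) ≤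
          (1 + 8 * u) * (r₀ + u * ((2 + 2 * K) * r₀ + 5 * (b * K))) :=
        mul_le_mul_of_nonneg_left (by linarith) (by linarith)
      -- Since u ≤ 1/6, 1 + 8u ≤ 3. The coefficients add up to 8 + 3(2 + 2K) = 14 + 6K for the risk
      -- and 3 · 5K + K = 16K for the remainder.
      have i₇ : (1 + 8 * u) * (u * ((2 + 2 * K) * r₀ + 5 * (b * K))) ≤
          3 * (u * ((2 + 2 * K) * r₀ + 5 * (b * K))) :=
        mul_le_mul_of_nonneg_right (by linarith) (by positivity)
      linarith
    exact ⟨(key 1 le_rfl).1, fun N₀ hN₀ => (key N₀ hN₀).2⟩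

theorem theorem1 (β C₁ C₂ C₃ : ℝ) (hβ : 0 ≤ β) (hC₁ : 0 < C₁) (hC₂ : 0 < C₂) (hC₃ : 0 < C₃) :
    ∃ Cstar : ℝ, 0 < Cstar ∧ ∃ γ₀ : ℝ, 0 < γ₀ ∧
      ∀ (Ω : Type*) [MeasurableSpace Ω] (P : Measure Ω) [IsProbabilityMeasure P]
        (ξ : ℕ → Ω → ℝ),
        (∀ k : ℕ, 1 ≤ k → HasLaw (ξ k) (gaussianReal 0 1) P) →
        iIndepFun (fun k : ℕ => ξ (k + 1)) P →
      ∀ σ : ℕ → ℝ, PolynomialHypothesis β C₁ C₂ C₃ σ →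
      ∀ θ : ℕ → ℝ, Summable (fun k : ℕ => θ k ^ 2) →
      ∀ γ : ℝ, 0 < γ → γ ≤ γ₀ → ∀ α : ℝ, 1 < α →
        -- almost surely, the minimization problem that defines the bandwidth has a solution
        (∀ᵐ ω ∂P, ∃ N : ℕ, IsBandwidth σ (penalty σ (U0 P σ ξ) α)
          (observation θ σ (fun k => ξ k ω)) N) ∧
        -- every random bandwidth that solves it satisfies the oracle inequality
        ∀ Nrhm : Ω → ℕ, AEMeasurable Nrhm P →
          (∀ᵐ ω ∂P, IsBandwidth σ (penalty σ (U0 P σ ξ) α)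
            (observation θ σ (fun k => ξ k ω)) (Nrhm ω)) →
          Integrable (fun ω => sqDist
            (projectionEstimator (observation θ σ (fun k => ξ k ω)) (Nrhm ω)) θ) P ∧
          ∫ ω, sqDist
              (projectionEstimator (observation θ σ (fun k => ξ k ω)) (Nrhm ω)) θ ∂P ≤
            (1 + γ) * (⨅ N : {N : ℕ // 1 ≤ N}, rhmRisk θ σ (U0 P σ ξ) α (N : ℕ)) +
              Cstar * σ 1 ^ 2 * (1 / γ ^ (4 * β + 1) + 1 / (α - 1)) := by
  obtain ⟨K, hK, H⟩ := exists_risk_bound hβ hC₁ C₂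
  -- The risk bound is applied at γ/L, which makes its leading factor exactly 1 + γ; the rescaling
  -- puts L^{4β+1} into the constant.
  set L := (14 + 6 * K) * K with hL
  have hL0 : 0 < L := by positivity
  refine ⟨16 * K * K * L ^ (4 * β + 1), by positivity, min L 1, by positivity, ?_⟩
  intro Ω _ P _ ξ hlaw hind σ hσ θ hθ γ hγ hγ₀ α hα
  have hpos := hσ.pos
  have hγL : γ ≤ L := hγ₀.trans (min_le_left _ _)
  have hγ1 : γ ≤ 1 := hγ₀.trans (min_le_right _ _)
  have hu : K * (γ / L) ≤ 1 / 6 := by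
    rw [← mul_div_assoc, div_le_iff₀ hL0, hL]
    nlinarith
  obtain ⟨hex, hrisk⟩ := H ⟨hlaw, hind⟩ hσ hθ (div_pos hγ hL0) ((div_le_one hL0).2 hγL) hu
    (by linarith : 0 ≤ 1 + α) (U0_nonneg P σ ξ)
  refine ⟨hex, fun N hNm hN => ?_⟩
  obtain ⟨hint, hle⟩ := hrisk N hNm hN
  refine ⟨hint, ?_⟩
  have e1 : (14 + 6 * K) * (K * (γ / L)) = γ := by
    rw [hL]
    field_simp
  have e2 : 16 * K * (K * (γ / L)) * (σ 1 ^ 2 * varianceThreshold β (γ / L)) =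
      16 * K * K * L ^ (4 * β + 1) * σ 1 ^ 2 * (1 / γ ^ (4 * β + 1)) := by
    have h := mul_varianceThreshold (β := β) (div_pos hγ hL0)
    rw [Real.div_rpow hγ.le hL0.le, one_div_div] at h
    calc _ = 16 * K * K * σ 1 ^ 2 * (γ / L * varianceThreshold β (γ / L)) := by ring
      _ = _ := by rw [h]; ring
  rw [e1, e2] at hle
  -- The 1/(α − 1) term only enlarges the right side, as the bound already holds with the γ term
  -- alone.
  have hα' : 0 ≤ 16 * K * K * L ^ (4 * β + 1) * σ 1 ^ 2 * (1 / (α - 1)) := by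
    have : 0 < α - 1 := by linarith
    positivity
  have hne : Nonempty {N : ℕ // 1 ≤ N} := ⟨⟨1, le_rfl⟩⟩
  have hinf : ((∫ ω, sqDist (projectionEstimator (observation θ σ (fun k => ξ k ω)) (N ω)) θ ∂P) -
      16 * K * K * L ^ (4 * β + 1) * σ 1 ^ 2 * (1 / γ ^ (4 * β + 1))) / (1 + γ) ≤
      ⨅ N : {N : ℕ // 1 ≤ N}, rhmRisk θ σ (U0 P σ ξ) α (N : ℕ) := by
    refine le_ciInf fun n => ?_
    rw [div_le_iff₀ (by linarith)]
    linarith [hle n n.2]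
  rw [div_le_iff₀ (by linarith)] at hinf
  linarith

end
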